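/- **Setting.** Let $n\ge 1$ and let $M_n(\mathbb C)$ be the algebra of complex $n\times n$ matrices. Write $M_n(\mathbb C)=\mathfrak l\oplus\mathfrak a$, where $\mathfrak a=\{A: A^\dagger=-A\}$ and $\mathfrak l$ is the real vector space of lower triangular matrices with real diagonal entries, and define $R(L+A)=L-A$ for $L\in\mathfrak l$, $A\in\mathfrak a$. Let $\langle X,Y\rangle=\operatorname{Im}\operatorname{Tr}(XY)$, and for a smooth real-valued function $\varphi$ on an open subset of $M_n(\mathbb C)$ let $\nabla\varphi$ be defined by $\frac{d}{dt}\big|_{t=0}\varphi(X+tB)=\langle\nabla\varphi|_X,B\rangle$ for all $B$. The Gelfand–Dikij (GD) bracket is $$\{\varphi_1,\varphi_2\}\big|_X=\tfrac12\langle R(\nabla\varphi_1\,X),\nabla\varphi_2\,X\rangle-\tfrac12\langle R(X\,\nabla\varphi_1),X\,\nabla\varphi_2\rangle ,$$ extended complex-bilinearly to complex-valued functions. For $\alpha_0,\dots,\alpha_{n-2}\in\mathbb D$, $\alpha_{n-1}\in S^1$ put $\rho_k=\sqrt{1-|\alpha_k|^2}$, $\Xi_k=\begin{bmatrix}\bar\alpha_k&\rho_k\\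 \rho_k&-\alpha_k\end{bmatrix}$ for $0\le k\le n-2$, and $\Xi_{-1}=[1]$, $\Xi_{n-1}=[\bar\alpha_{n-1}]$. The associated CMV matrix is $\mathcal C=\mathcal L\mathcal M$ with $\mathcal L=\operatorname{diag}(\Xi_0,\Xi_2,\dots)$ and $\mathcal M=\operatorname{diag}(\Xi_{-1},\Xi_1,\Xi_3,\dots)$. It is unitary with $n$ distinct eigenvalues $z_1,\dots,z_n$; its spectral measure with respect to $e_1=(1,0,\dots,0)^T$ is $\sum_{j=1}^n\mu_j\delta_{z_j}$, where $\mu_j=|\langle v_j,e_1\rangle|^2$ for a unit eigenvector $v_j$ belonging to $z_j$. **Theorem.** Let $\mathcal C$ be an $n\times n$ CMV matrix. There are smooth complex-valued functions $z_1,\dots,z_n,\mu_1,\dots,\mu_n$ on a neighbourhood of $\mathcal C$ in $M_n(\mathbb C)$ whose values at every CMV matrix near $\mathcal C$ are the eigenvalues, and the corresponding masses of the spectral measure with respect to $e_1$, of that matrix. For every such choice of functions (in particular, whatever the labelling of the eigenvalues and the extension to matrices that are not CMV), the GD brackets at $\mathcal C$ are, for $1\le s,t\le n$, $$\{z_s,z_t\}=0,\qquad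 \{z_s,\mu_t\}=2iz_s\mu_t(\delta_{st}-\mu_s),$$ and $\{\mu_s,\mu_s\}=0$, while for $s\ne t$ $$\{\mu_s,\mu_t\}=2i\mu_s\mu_t\left[\sum_{k\neq s}\frac{z_k+z_s}{z_k-z_s}\mu_k+\sum_{k\neq t}\frac{z_t+z_k}{z_t-z_k}\mu_k+\frac{z_s+z_t}{z_s-z_t}\right].$$ -/

import Mathlib

open Matrix Filter Topology
open scoped ContDiff ComplexConjugate

-- The (finite-dimensional) space of complex matrices is normed by the sup norm of the entries; only
-- differentiability and smoothness are used, which do not depend on the choice of the norm.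
attribute [local instance] Matrix.normedAddCommGroup Matrix.normedSpace

namespace CMV

variable {n : ℕ}

/-- Verblunsky coefficients `(α₀, …, α_{n-1}) ∈ 𝔻ⁿ⁻¹ × S¹`. -/
def IsVerblunsky (α : Fin n → ℂ) : Prop :=
  (∀ k : Fin n, (k : ℕ) + 1 < n → ‖α k‖ < 1) ∧ (∀ k : Fin n, (k : ℕ) + 1 = n → ‖α k‖ = 1)

/-- The number `ρ = √(1 - |a|²)`. -/
noncomputable def rho (a : ℂ) : ℝ := Real.sqrt (1 - ‖a‖ ^ 2)

/-- The block-diagonal matrix built from the blocks `Ξ_k` with `k ≡ p (mod 2)`, where the `2 × 2` block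
`Ξ_k = [[conj α_k, ρ_k], [ρ_k, -α_k]]` for `0 ≤ k ≤ n - 2` occupies the rows and columns `k, k + 1`
(counted from `0`), while the `1 × 1` blocks are `Ξ_{-1} = [1]` at position `0` and
`Ξ_{n-1} = [conj α_{n-1}]` at position `n - 1`. -/
noncomputable def factor (p : ℕ) (α : Fin n → ℂ) : Matrix (Fin n) (Fin n) ℂ :=
  Matrix.of fun i j =>
    if i = j then
      if (i : ℕ) % 2 = p then conj (α i)
      else if (i : ℕ) = 0 then 1
      else -α ⟨(i : ℕ) - 1, lt_of_le_of_lt (Nat.sub_le _ _) i.isLt⟩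
    else if (i : ℕ) + 1 = j ∧ (i : ℕ) % 2 = p then (rho (α i) : ℂ)
    else if (j : ℕ) + 1 = i ∧ (j : ℕ) % 2 = p then (rho (α j) : ℂ)
    else 0

/-- The CMV matrix `𝒞 = ℒ ℳ`, with `ℒ = diag(Ξ₀, Ξ₂, …)` and `ℳ = diag(Ξ₋₁, Ξ₁, Ξ₃, …)`. -/
noncomputable def cmvMatrix (α : Fin n → ℂ) : Matrix (Fin n) (Fin n) ℂ :=
  factor 0 α * factor 1 α

/-- The set of all `n × n` CMV matrices. -/
def cmvSet (n : ℕ) : Set (Matrix (Fin n) (Fin n) ℂ) :=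
  {X | ∃ α : Fin n → ℂ, IsVerblunsky α ∧ X = cmvMatrix α}

/-- The matrix `X` has the pairwise distinct eigenvalues `z j`, with an orthonormal basis of eigenvectors
`v j`, and the spectral measure of `X` and `e₁` is `∑ j, μ j • δ_{z j}`,
that is, `μ j = |⟨v j, e₁⟩|²`. -/
def IsSpectralData [NeZero n] (X : Matrix (Fin n) (Fin n) ℂ) (z μ : Fin n → ℂ) : Prop :=
  Function.Injective z ∧
    ∃ v : OrthonormalBasis (Fin n) ℂ (EuclideanSpace ℂ (Fin n)),
      ∀ j, X *ᵥ (v j).ofLp = z j • (v j).ofLp ∧ μ j = ((‖(v j) 0‖ ^ 2 : ℝ) : ℂ)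

/-- `Z s` and `M t` are smooth functions on a neighbourhood of `C` in the space of all `n × n` complex
matrices, whose values at the CMV matrices `X` near `C` are the eigenvalues and the masses of the
spectral measure of `X` and `e₁`. No condition is imposed at matrices that are not CMV. -/
def IsLocalSpectralFamily [NeZero n] (C : Matrix (Fin n) (Fin n) ℂ)
    (Z M : Fin n → Matrix (Fin n) (Fin n) ℂ → ℂ) : Prop :=
  (∀ s, ∀ᶠ X in 𝓝 C, ContDiffAt ℝ ∞ (Z s) X) ∧
  (∀ s, ∀ᶠ X in 𝓝 C, ContDiffAt ℝ ∞ (M s) X) ∧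
  ∀ᶠ X in 𝓝 C, X ∈ cmvSet n → IsSpectralData X (fun s => Z s X) (fun s => M s X)

/-- The projection onto the skew-Hermitian matrices `𝔞` along the space `𝔩` of the lower triangular
matrices with real diagonal. -/
noncomputable def skewPart (X : Matrix (Fin n) (Fin n) ℂ) : Matrix (Fin n) (Fin n) ℂ :=
  Matrix.of fun i j =>
    if i < j then X i j
    else if j < i then -conj (X j i)
    else ((X i i).im : ℂ) * Complex.I

/-- The projection onto `𝔩` along `𝔞`. -/
noncomputable def lowerPart (X : Matrix (Fin n) (Fin n) ℂ) : Matrix (Fin n) (Fin n) ℂ :=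
  X - skewPart X

theorem skewPart_conjTranspose (X : Matrix (Fin n) (Fin n) ℂ) : (skewPart X)ᴴ = -skewPart X := by
  ext i j
  rcases lt_trichotomy i j with h | h | h
  · simp [skewPart, h, h.not_gt]
  · subst h
    simp [skewPart]
  · simp [skewPart, h, h.not_gt]

theorem lowerPart_lower (X : Matrix (Fin n) (Fin n) ℂ) :
    (∀ i j, i < j → lowerPart X i j = 0) ∧ ∀ i, (lowerPart X i i).im = 0 := by
  constructor
  · intro i j h
    simp [lowerPart, skewPart, h]
  · intro i
    simp [lowerPart, skewPart]

theorem skewPart_unique (L A : Matrix (Fin n) (Fin n) ℂ) (hA : Aᴴ = -A)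
    (hL : ∀ i j, i < j → L i j = 0) (hL' : ∀ i, (L i i).im = 0) : skewPart (L + A) = A := by
  have hA' : ∀ i j, conj (A j i) = -A i j := fun i j => by
    have := congrFun (congrFun hA i) j
    simpa using this
  ext i j
  rcases lt_trichotomy i j with h | h | h
  · simp [skewPart, h, hL i j h]
  · subst h
    have h1 := congrArg Complex.re (hA' i i)
    simp only [Complex.conj_re, Complex.neg_re] at h1
    apply Complex.ext
    · simp [skewPart]
      linarith
    · simp [skewPart, hL']
  · simp [skewPart, h, h.not_gt, hL j i h, hA']

/-- The classical R-matrix `R(L + A) = L - A` for `L ∈ 𝔩`, `A ∈ 𝔞`. -/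
noncomputable def rMap (X : Matrix (Fin n) (Fin n) ℂ) : Matrix (Fin n) (Fin n) ℂ :=
  lowerPart X - skewPart X

/-- The pairing `⟨X, Y⟩ = Im Tr (X Y)`. -/
noncomputable def pairing (X Y : Matrix (Fin n) (Fin n) ℂ) : ℝ := (Matrix.trace (X * Y)).im

/-- The gradient of a real-valued function of a matrix with entries `b_{k,l} = u_{k,l} + i v_{k,l}`:
`[∇φ]_{k,l} = ∂φ/∂v_{l,k} + i ∂φ/∂u_{l,k}`. -/
noncomputable def grad (φ : Matrix (Fin n) (Fin n) ℂ → ℝ) (X : Matrix (Fin n) (Fin n) ℂ) :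
    Matrix (Fin n) (Fin n) ℂ :=
  Matrix.of fun k l =>
    (fderiv ℝ φ X (Matrix.single l k Complex.I) : ℂ)
      + Complex.I * (fderiv ℝ φ X (Matrix.single l k 1) : ℂ)

/-- The gradient represents the derivative with respect to the pairing. -/
theorem pairing_grad (φ : Matrix (Fin n) (Fin n) ℂ → ℝ) (X B : Matrix (Fin n) (Fin n) ℂ) :
    pairing (grad φ X) B = fderiv ℝ φ X B := by
  have hB : B = ∑ i, ∑ j, ((B i j).re • Matrix.single i j (1 : ℂ)
      + (B i j).im • Matrix.single i j Complex.I) := by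
    conv_lhs => rw [Matrix.matrix_eq_sum_single B]
    refine Finset.sum_congr rfl fun i _ => Finset.sum_congr rfl fun j _ => ?_
    rw [Matrix.smul_single, Matrix.smul_single, ← Matrix.single_add]
    congr 1
    simp
  conv_rhs => rw [hB]
  simp only [map_sum, map_add, map_smul, smul_eq_mul]
  simp only [pairing, Matrix.trace, Matrix.diag_apply, Matrix.mul_apply, Complex.im_sum]
  rw [Finset.sum_comm]
  refine Finset.sum_congr rfl fun i _ => Finset.sum_congr rfl fun j _ => ?_
  simp [grad]
  ring

/-- The Gelfand-Dikij bracket of two real-valued functions on the space of `n × n` matrices. -/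
noncomputable def gdBracketReal (φ₁ φ₂ : Matrix (Fin n) (Fin n) ℂ → ℝ)
    (X : Matrix (Fin n) (Fin n) ℂ) : ℝ :=
  1 / 2 * pairing (rMap (grad φ₁ X * X)) (grad φ₂ X * X)
    - 1 / 2 * pairing (rMap (X * grad φ₁ X)) (X * grad φ₂ X)

/-- The complex-bilinear extension of the Gelfand-Dikij bracket to complex-valued functions. -/
noncomputable def gdBracket (f g : Matrix (Fin n) (Fin n) ℂ → ℂ)
    (X : Matrix (Fin n) (Fin n) ℂ) : ℂ :=
  ((gdBracketReal (fun Y => (f Y).re) (fun Y => (g Y).re) X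
      - gdBracketReal (fun Y => (f Y).im) (fun Y => (g Y).im) X : ℝ) : ℂ)
    + Complex.I * ((gdBracketReal (fun Y => (f Y).re) (fun Y => (g Y).im) X
      + gdBracketReal (fun Y => (f Y).im) (fun Y => (g Y).re) X : ℝ) : ℂ)

end CMV

namespace CMV

variable {n : ℕ}

/-! ### The splitting `𝔩 ⊕ 𝔞` and the Gelfand-Dikij form -/

/-! The bracket at `X` is the pairing of the second gradient with the Hamiltonian vector `skewPart
(X * G) * X - X * skewPart (G * X)` of the first gradient `G`, and it is antisymmetric. At a CMV
matrix every Hamiltonian vector is the velocity of a curve of CMV matrices (`exists_curve`): the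
Hamiltonian vector of a product `ℒ ℳ` splits by a Leibniz rule, and on each unitary block-diagonal
factor it is a variation of the Verblunsky coefficients that keeps the last one fixed. Hence the
bracket sees only the restriction of a function to the CMV matrices, and any matrix representing the
derivative along Hamiltonian vectors may replace the gradient (`gdBracketReal_eq_gdForm`). This
gives independence of the extension.

Along such a curve first-order perturbation theory for the eigenprojections `P t` applies: `P t`
represents the derivative of the eigenvalue and `massGrad` that of the mass. For these
representatives the left and right translates are `S + T` and `S - T`. For an eigenvalue `T = 0`.
For a mass `T` is a multiple of the commutator of `P t` with the projection onto `e₁`, so it lives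
in the first row and column and its splitting into lower and skew parts is explicit. All brackets
then become traces of products of the `P k` with that rank-one projection (`gdForm_eigenvalue_mass`,
`gdForm_mass_mass`).

Existence of smooth spectral data follows from cyclicity of `e₁`, which makes the spectrum simple,
the implicit function theorem for the characteristic polynomial, and Lagrange interpolation for the
projections. -/

theorem skewPart_add (A B : Matrix (Fin n) (Fin n) ℂ) :
    skewPart (A + B) = skewPart A + skewPart B := by
  ext i j
  simp only [skewPart, of_apply, Matrix.add_apply]
  split_ifs
  · rfl
  · simp [add_comm]
  · simp [add_mul]

theorem skewPart_neg (A : Matrix (Fin n) (Fin n) ℂ) : skewPart (-A) = -skewPart A := by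
  ext i j
  simp only [skewPart, of_apply, Matrix.neg_apply]
  split_ifs <;> simp

theorem skewPart_sub (A B : Matrix (Fin n) (Fin n) ℂ) :
    skewPart (A - B) = skewPart A - skewPart B := by
  rw [sub_eq_add_neg, skewPart_add, skewPart_neg, sub_eq_add_neg]

theorem skewPart_eq_self {A : Matrix (Fin n) (Fin n) ℂ} (hA : Aᴴ = -A) : skewPart A = A := by
  simpa using skewPart_unique 0 A hA (by simp) (by simp)

theorem lowerPart_add_skewPart (A : Matrix (Fin n) (Fin n) ℂ) :
    lowerPart A + skewPart A = A := by
  simp [lowerPart]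

theorem pairing_comm (A B : Matrix (Fin n) (Fin n) ℂ) : pairing A B = pairing B A := by
  rw [pairing, pairing, trace_mul_comm]

theorem pairing_add_left (A B D : Matrix (Fin n) (Fin n) ℂ) :
    pairing (A + B) D = pairing A D + pairing B D := by
  simp [pairing, add_mul]

theorem pairing_add_right (A B D : Matrix (Fin n) (Fin n) ℂ) :
    pairing A (B + D) = pairing A B + pairing A D := by
  simp [pairing, mul_add]

theorem pairing_sub_left (A B D : Matrix (Fin n) (Fin n) ℂ) :
    pairing (A - B) D = pairing A D - pairing B D := by
  simp [pairing, sub_mul]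

theorem pairing_sub_right (A B D : Matrix (Fin n) (Fin n) ℂ) :
    pairing A (B - D) = pairing A B - pairing A D := by
  simp [pairing, mul_sub]

/-- The trace of a product of two skew-Hermitian matrices is real, so `𝔞` is isotropic. With the
isotropy of `𝔩` this makes the two projections adjoint to each other. -/
theorem pairing_skewPart_skewPart (A B : Matrix (Fin n) (Fin n) ℂ) :
    pairing (skewPart A) (skewPart B) = 0 := by
  have h : conj (trace (skewPart A * skewPart B)) = trace (skewPart A * skewPart B) := by
    rw [starRingEnd_apply, ← trace_conjTranspose, conjTranspose_mul, skewPart_conjTranspose,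
      skewPart_conjTranspose, neg_mul_neg, trace_mul_comm]
  exact Complex.conj_eq_iff_im.mp h

theorem pairing_lowerPart_lowerPart (A B : Matrix (Fin n) (Fin n) ℂ) :
    pairing (lowerPart A) (lowerPart B) = 0 := by
  obtain ⟨hA, hA'⟩ := lowerPart_lower A
  obtain ⟨hB, hB'⟩ := lowerPart_lower B
  simp only [pairing, trace, diag_apply, mul_apply, Complex.im_sum]
  refine Finset.sum_eq_zero fun i _ => Finset.sum_eq_zero fun j _ => ?_
  rcases lt_trichotomy i j with h | h | h
  · simp [hA i j h]
  · subst h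
    simp [hA', hB']
  · simp [hB j i h]

theorem pairing_skewPart_left (A B : Matrix (Fin n) (Fin n) ℂ) :
    pairing (skewPart A) B = pairing A (lowerPart B) := by
  conv_lhs => rw [← lowerPart_add_skewPart B]
  conv_rhs => rw [← lowerPart_add_skewPart A]
  rw [pairing_add_right, pairing_add_left, pairing_skewPart_skewPart, pairing_lowerPart_lowerPart]
  ring

/-- The Gelfand-Dikij form at `X`, as a bilinear form in the gradients. -/
noncomputable def gdForm (X G H : Matrix (Fin n) (Fin n) ℂ) : ℝ :=
  1 / 2 * pairing (rMap (G * X)) (H * X) - 1 / 2 * pairing (rMap (X * G)) (X * H)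

/-- The value at `X` of the Hamiltonian vector field belonging to the gradient `G`. -/
noncomputable def hamiltonian (X G : Matrix (Fin n) (Fin n) ℂ) : Matrix (Fin n) (Fin n) ℂ :=
  skewPart (X * G) * X - X * skewPart (G * X)

/-- Since `R` is the identity minus twice `skewPart`, the identity parts of the two terms cancel by
cyclicity of the trace. -/
theorem gdForm_eq_sub (X G H : Matrix (Fin n) (Fin n) ℂ) :
    gdForm X G H = pairing (skewPart (X * G)) (X * H) - pairing (skewPart (G * X)) (H * X) := by
  have h : pairing (G * X) (H * X) = pairing (X * G) (X * H) := by
    simp only [pairing]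
    rw [trace_mul_comm, mul_assoc, ← mul_assoc X G X, trace_mul_comm, mul_assoc]
  simp only [gdForm, rMap, lowerPart, pairing_sub_left, h]
  ring

theorem gdForm_eq_pairing_hamiltonian (X G H : Matrix (Fin n) (Fin n) ℂ) :
    gdForm X G H = pairing H (hamiltonian X G) := by
  rw [gdForm_eq_sub, hamiltonian, pairing_sub_right]
  congr 1
  · rw [pairing_comm, pairing, pairing, mul_assoc, trace_mul_comm, mul_assoc]
  · rw [pairing_comm, pairing, pairing, mul_assoc]

theorem gdForm_antisymm (X G H : Matrix (Fin n) (Fin n) ℂ) : gdForm X G H = -gdForm X H G := by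
  have h : pairing (G * X) (H * X) = pairing (X * G) (X * H) := by
    simp only [pairing]
    rw [trace_mul_comm, mul_assoc, ← mul_assoc X G X, trace_mul_comm, mul_assoc]
  rw [gdForm_eq_sub, gdForm_eq_sub, pairing_skewPart_left, pairing_skewPart_left, lowerPart,
    lowerPart, pairing_sub_right, pairing_sub_right, h, pairing_comm (X * G) (skewPart _),
    pairing_comm (G * X) (skewPart _)]
  ring

/-- The Gelfand-Dikij form in terms of the symmetric and antisymmetric parts of the left and right
translated gradients. -/
theorem gdForm_of_add_sub {X G H S S' T T' : Matrix (Fin n) (Fin n) ℂ}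
    (h₁ : X * G = S + T) (h₂ : G * X = S - T) (h₃ : X * H = S' + T') (h₄ : H * X = S' - T') :
    gdForm X G H = 2 * pairing S (lowerPart T') + 2 * pairing (skewPart T) S' := by
  rw [gdForm_eq_sub, h₁, h₂, h₃, h₄, skewPart_add, skewPart_sub]
  simp only [pairing_add_left, pairing_add_right, pairing_sub_left, pairing_sub_right,
    ← pairing_skewPart_left S T']
  ring

/-! ### Block diagonal matrices -/

/-- The block diagonal matrix with the `2 × 2` blocks `[[a k, b k], [c k, d k]]` in the rows and columns
`k, k + 1`, for `k ≡ p (mod 2)`, truncated at the last row and column, and with the entry `e` at the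
position `0` when this is not covered by a block. -/
def blockDiag (p : ℕ) (a b c d : Fin n → ℂ) (e : ℂ) : Matrix (Fin n) (Fin n) ℂ :=
  Matrix.of fun i j =>
    if i = j then
      if (i : ℕ) % 2 = p then a i
      else if (i : ℕ) = 0 then e
      else d ⟨(i : ℕ) - 1, lt_of_le_of_lt (Nat.sub_le _ _) i.isLt⟩
    else if (i : ℕ) + 1 = j ∧ (i : ℕ) % 2 = p then b i
    else if (j : ℕ) + 1 = i ∧ (j : ℕ) % 2 = p then c j
    else 0

theorem factor_eq_blockDiag (p : ℕ) (α : Fin n → ℂ) :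
    factor p α = blockDiag p (fun k => conj (α k)) (fun k => (rho (α k) : ℂ))
      (fun k => (rho (α k) : ℂ)) (fun k => -α k) 1 := rfl

theorem index_cases {p : ℕ} (hp : p < 2) (i : Fin n) :
    ((i : ℕ) + 1 < n ∧ (i : ℕ) % 2 = p) ∨ ((i : ℕ) % 2 = p ∧ (i : ℕ) + 1 = n) ∨
      ((i : ℕ) = 0 ∧ (i : ℕ) % 2 ≠ p) ∨
      ∃ (k : Fin n) (h : (k : ℕ) + 1 < n), (k : ℕ) % 2 = p ∧ i = ⟨k + 1, h⟩ := by
  have hi := i.isLt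
  by_cases h : (i : ℕ) % 2 = p
  · by_cases h' : (i : ℕ) + 1 < n
    · exact Or.inl ⟨h', h⟩
    · exact Or.inr (Or.inl ⟨h, by omega⟩)
  · by_cases h' : (i : ℕ) = 0
    · exact Or.inr (Or.inr (Or.inl ⟨h', h⟩))
    · refine Or.inr (Or.inr (Or.inr ⟨⟨i - 1, by omega⟩, by simp; omega, by simp; omega, ?_⟩))
      ext
      simp
      omega

section Rows

variable {p : ℕ} (a b c d : Fin n → ℂ) (e : ℂ)

theorem blockDiag_eq_zero {i j : Fin n} (h : i ≠ j) (h₁ : ¬((i : ℕ) + 1 = j ∧ (i : ℕ) % 2 = p))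
    (h₂ : ¬((j : ℕ) + 1 = i ∧ (j : ℕ) % 2 = p)) : blockDiag p a b c d e i j = 0 := by
  simp only [blockDiag, of_apply, h, h₁, h₂, if_false]

theorem blockDiag_head_head {i : Fin n} (h : (i : ℕ) % 2 = p) :
    blockDiag p a b c d e i i = a i := by
  simp [blockDiag, h]

theorem blockDiag_head_tail {i : Fin n} (h : (i : ℕ) % 2 = p) (hi : (i : ℕ) + 1 < n) :
    blockDiag p a b c d e i ⟨i + 1, hi⟩ = b i := by
  have : i ≠ ⟨i + 1, hi⟩ := fun h => by simpa using congrArg Fin.val h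
  simp [blockDiag, h, this]

theorem blockDiag_tail_head {i : Fin n} (h : (i : ℕ) % 2 = p) (hi : (i : ℕ) + 1 < n) :
    blockDiag p a b c d e ⟨i + 1, hi⟩ i = c i := by
  have : (⟨i + 1, hi⟩ : Fin n) ≠ i := fun h => by simpa using congrArg Fin.val h
  have h' : ¬(i : ℕ) + 1 + 1 = i := by omega
  simp [blockDiag, h, this, h']

theorem blockDiag_tail_tail {i : Fin n} (h : (i : ℕ) % 2 = p) (hi : (i : ℕ) + 1 < n) :
    blockDiag p a b c d e ⟨i + 1, hi⟩ ⟨i + 1, hi⟩ = d i := by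
  have : ¬((i : ℕ) + 1) % 2 = p := by omega
  simp [blockDiag, this]

theorem blockDiag_first {i : Fin n} (hi : (i : ℕ) = 0) (h : (i : ℕ) % 2 ≠ p) :
    blockDiag p a b c d e i i = e := by
  rw [blockDiag, of_apply, if_pos rfl, if_neg h, if_pos hi]

theorem sum_blockDiag_head {i : Fin n} (h : (i : ℕ) % 2 = p) (hi : (i : ℕ) + 1 < n)
    (g : Fin n → ℂ) :
    ∑ j, blockDiag p a b c d e i j * g j = a i * g i + b i * g ⟨i + 1, hi⟩ := by
  have hne : i ≠ ⟨i + 1, hi⟩ := fun h => by simpa using congrArg Fin.val h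
  rw [Fintype.sum_eq_add i ⟨i + 1, hi⟩ hne, blockDiag_head_head _ _ _ _ _ h,
    blockDiag_head_tail _ _ _ _ _ h]
  rintro j ⟨h1, h2⟩
  have h2' : (j : ℕ) ≠ i + 1 := fun h => h2 (Fin.ext h)
  rw [blockDiag_eq_zero _ _ _ _ _ (Ne.symm h1) (by omega) (by omega), zero_mul]

theorem sum_blockDiag_tail {i : Fin n} (h : (i : ℕ) % 2 = p) (hi : (i : ℕ) + 1 < n)
    (g : Fin n → ℂ) :
    ∑ j, blockDiag p a b c d e ⟨i + 1, hi⟩ j * g j = c i * g i + d i * g ⟨i + 1, hi⟩ := by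
  have hne : i ≠ ⟨i + 1, hi⟩ := fun h => by simpa using congrArg Fin.val h
  rw [Fintype.sum_eq_add i ⟨i + 1, hi⟩ hne, blockDiag_tail_head _ _ _ _ _ h,
    blockDiag_tail_tail _ _ _ _ _ h]
  rintro j ⟨h1, h2⟩
  have h1' : (j : ℕ) ≠ i := fun h => h1 (Fin.ext h)
  rw [blockDiag_eq_zero _ _ _ _ _ (Ne.symm h2) (by simp; omega) (by simp; omega), zero_mul]

theorem sum_blockDiag_last {i : Fin n} (h : (i : ℕ) % 2 = p) (hi : (i : ℕ) + 1 = n)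
    (g : Fin n → ℂ) : ∑ j, blockDiag p a b c d e i j * g j = a i * g i := by
  rw [Fintype.sum_eq_single i, blockDiag_head_head _ _ _ _ _ h]
  intro j hj
  have := j.isLt
  have hj' : (j : ℕ) ≠ i := fun h => hj (Fin.ext h)
  rw [blockDiag_eq_zero _ _ _ _ _ (Ne.symm hj) (by omega) (by omega), zero_mul]

theorem sum_blockDiag_first {i : Fin n} (hi : (i : ℕ) = 0) (h : (i : ℕ) % 2 ≠ p)
    (g : Fin n → ℂ) : ∑ j, blockDiag p a b c d e i j * g j = e * g i := by
  rw [Fintype.sum_eq_single i, blockDiag_first _ _ _ _ _ hi h]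
  intro j hj
  rw [blockDiag_eq_zero _ _ _ _ _ (Ne.symm hj) (by omega) (by omega), zero_mul]

end Rows

/-- Only indices of parity `p` enter the matrix, and at the last index the block is truncated to its
corner `a`. -/
theorem blockDiag_congr {p : ℕ} (hp : p < 2) {a b c d a' b' c' d' : Fin n → ℂ} {e e' : ℂ}
    (h : ∀ k : Fin n, (k : ℕ) % 2 = p → (k : ℕ) + 1 < n →
      a k = a' k ∧ b k = b' k ∧ c k = c' k ∧ d k = d' k)
    (hlast : ∀ k : Fin n, (k : ℕ) % 2 = p → (k : ℕ) + 1 = n → a k = a' k) (he : e = e') :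
    blockDiag p a b c d e = blockDiag p a' b' c' d' e' := by
  apply Matrix.ext_of_mulVec_single
  intro j
  ext i
  simp only [mulVec, dotProduct]
  rcases index_cases hp i with ⟨hi, hi'⟩ | ⟨hi', hi⟩ | ⟨hi, hi'⟩ | ⟨k, hk, hk', rfl⟩
  · obtain ⟨h1, h2, h3, h4⟩ := h i hi' hi
    rw [sum_blockDiag_head _ _ _ _ _ hi' hi, sum_blockDiag_head _ _ _ _ _ hi' hi, h1, h2]
  · rw [sum_blockDiag_last _ _ _ _ _ hi' hi, sum_blockDiag_last _ _ _ _ _ hi' hi, hlast i hi' hi]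
  · rw [sum_blockDiag_first _ _ _ _ _ hi hi', sum_blockDiag_first _ _ _ _ _ hi hi', he]
  · obtain ⟨h1, h2, h3, h4⟩ := h k hk' hk
    rw [sum_blockDiag_tail _ _ _ _ _ hk' hk, sum_blockDiag_tail _ _ _ _ _ hk' hk, h3, h4]

theorem blockDiag_one (p : ℕ) :
    blockDiag p (fun _ => 1) (fun _ => 0) (fun _ => 0) (fun _ => 1) 1
      = (1 : Matrix (Fin n) (Fin n) ℂ) := by
  ext i j
  simp [blockDiag, Matrix.one_apply]

theorem blockDiag_conjTranspose (p : ℕ) (a b c d : Fin n → ℂ) (e : ℂ) :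
    (blockDiag p a b c d e)ᴴ = blockDiag p (fun k => conj (a k)) (fun k => conj (c k))
      (fun k => conj (b k)) (fun k => conj (d k)) (conj e) := by
  ext i j
  by_cases h : i = j
  · subst h
    simp only [blockDiag, conjTranspose_apply, of_apply, if_true]
    split_ifs <;> simp
  · simp only [blockDiag, conjTranspose_apply, of_apply, h, Ne.symm h, if_false]
    by_cases h1 : (i : ℕ) + 1 = j ∧ (i : ℕ) % 2 = p
    · have h2 : ¬((j : ℕ) + 1 = i ∧ (j : ℕ) % 2 = p) := by omega
      simp [h1, h2]
    · by_cases h2 : (j : ℕ) + 1 = i ∧ (j : ℕ) % 2 = p <;> simp [h1, h2]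

theorem blockDiag_mul {p : ℕ} (hp : p < 2) (a b c d a' b' c' d' : Fin n → ℂ) (e e' : ℂ)
    (hb : ∀ k : Fin n, (k : ℕ) + 1 = n → b k = 0) :
    -- The assumption on `b` at the last index removes the term `b k * c' k`, which the truncated `1
    -- × 1` block does not produce.
    blockDiag p a b c d e * blockDiag p a' b' c' d' e'
      = blockDiag p (fun k => a k * a' k + b k * c' k) (fun k => a k * b' k + b k * d' k)
        (fun k => c k * a' k + d k * c' k) (fun k => c k * b' k + d k * d' k) (e * e') := by
  apply Matrix.ext_of_mulVec_single
  intro j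
  rw [← mulVec_mulVec]
  ext i
  simp only [mulVec, dotProduct]
  rcases index_cases hp i with ⟨hi, hi'⟩ | ⟨hi', hi⟩ | ⟨hi, hi'⟩ | ⟨k, hk, hk', rfl⟩
  · simp only [sum_blockDiag_head _ _ _ _ _ hi' hi, sum_blockDiag_tail _ _ _ _ _ hi' hi]
    ring
  · simp only [sum_blockDiag_last _ _ _ _ _ hi' hi, hb i hi]
    ring
  · simp only [sum_blockDiag_first _ _ _ _ _ hi hi']
    ring
  · simp only [sum_blockDiag_head _ _ _ _ _ hk' hk, sum_blockDiag_tail _ _ _ _ _ hk' hk]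
    ring

/-! ### The factors of a CMV matrix -/

theorem rho_sq {a : ℂ} (h : ‖a‖ ≤ 1) : (rho a : ℂ) * rho a = 1 - a * conj a := by
  rw [Complex.mul_conj, Complex.normSq_eq_norm_sq, ← Complex.ofReal_mul, rho,
    Real.mul_self_sqrt (by nlinarith [norm_nonneg a])]
  simp

theorem rho_eq_zero {a : ℂ} (h : ‖a‖ = 1) : rho a = 0 := by simp [rho, h]

theorem rho_pos {a : ℂ} (h : ‖a‖ < 1) : 0 < rho a :=
  Real.sqrt_pos.mpr (by nlinarith [norm_nonneg a])

theorem IsVerblunsky.norm_le {α : Fin n → ℂ} (h : IsVerblunsky α) (k : Fin n) : ‖α k‖ ≤ 1 := by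
  rcases lt_or_eq_of_le (Nat.succ_le_of_lt k.isLt) with hk | hk
  · exact (h.1 k hk).le
  · exact (h.2 k hk).le

theorem factor_mul_conjTranspose {p : ℕ} (hp : p < 2) {α : Fin n → ℂ} (h : IsVerblunsky α) :
    factor p α * (factor p α)ᴴ = 1 := by
  rw [factor_eq_blockDiag, blockDiag_conjTranspose, blockDiag_mul hp _ _ _ _ _ _ _ _ _ _
    (fun k hk => by simp [rho_eq_zero (h.2 k hk)]), ← blockDiag_one p]
  have key := fun k => rho_sq (h.norm_le k)
  congr 1
  · ext k
    simp
    linear_combination key k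
  · ext k
    simp
    ring
  · ext k
    simp
    ring
  · ext k
    simp
    linear_combination key k
  · simp

theorem factor_conjTranspose_mul {p : ℕ} (hp : p < 2) {α : Fin n → ℂ} (h : IsVerblunsky α) :
    (factor p α)ᴴ * factor p α = 1 :=
  mul_eq_one_comm.mp (factor_mul_conjTranspose hp h)

theorem cmvMatrix_conjTranspose_mul {α : Fin n → ℂ} (h : IsVerblunsky α) :
    (cmvMatrix α)ᴴ * cmvMatrix α = 1 := by
  rw [cmvMatrix, conjTranspose_mul, mul_assoc, ← mul_assoc _ (factor 0 α),
    factor_conjTranspose_mul (by norm_num) h, one_mul, factor_conjTranspose_mul (by norm_num) h]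

/-! ### Hamiltonian vector fields are tangent to the set of CMV matrices -/

/-- The two middle terms, both `A * skewPart (B * G * A) * B`, cancel. This Leibniz rule reduces
tangency for `ℒ ℳ` to tangency for each factor. -/
theorem hamiltonian_mul (A B G : Matrix (Fin n) (Fin n) ℂ) :
    hamiltonian (A * B) G = hamiltonian A (B * G) * B + A * hamiltonian B (G * A) := by
  simp only [hamiltonian, sub_mul, mul_sub, mul_assoc]
  abel

/-- Here `A * G` is the unitary conjugate of `G * A`. Conjugation preserves skew-Hermitian matrices,
so the skew part of `G * A` cancels and only its lower part contributes. -/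
theorem hamiltonian_of_unitary {A : Matrix (Fin n) (Fin n) ℂ} (hA : Aᴴ * A = 1)
    (G : Matrix (Fin n) (Fin n) ℂ) :
    hamiltonian A G = skewPart (A * lowerPart (G * A) * Aᴴ) * A := by
  have hA' : A * Aᴴ = 1 := mul_eq_one_comm.mp hA
  have h1 : A * G = A * lowerPart (G * A) * Aᴴ + A * skewPart (G * A) * Aᴴ := by
    rw [← add_mul, ← mul_add, lowerPart_add_skewPart, mul_assoc, mul_assoc, hA', mul_one]
  have h2 : skewPart (A * skewPart (G * A) * Aᴴ) = A * skewPart (G * A) * Aᴴ := by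
    apply skewPart_eq_self
    simp [conjTranspose_mul, skewPart_conjTranspose, mul_assoc]
  rw [hamiltonian, h1, skewPart_add, h2, add_mul, mul_assoc (A * skewPart (G * A)), hA, mul_one]
  abel

/-- The derivative of `rho` at `a` in the direction `b`. -/
noncomputable def rhoDeriv (a b : ℂ) : ℝ := -(conj a * b).re / rho a

theorem hasDerivAt_rho {a : ℂ} (ha : ‖a‖ < 1) (b : ℂ) :
    HasDerivAt (fun τ : ℝ => rho (a + τ * b)) (rhoDeriv a b) 0 := by
  have h1 : HasDerivAt (fun τ : ℝ => 1 - ((a.re + τ * b.re) ^ 2 + (a.im + τ * b.im) ^ 2))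
      (-2 * (conj a * b).re) 0 := by
    have hr : HasDerivAt (fun τ : ℝ => a.re + τ * b.re) b.re 0 := by
      simpa using ((hasDerivAt_id (0 : ℝ)).mul_const b.re).const_add a.re
    have hi : HasDerivAt (fun τ : ℝ => a.im + τ * b.im) b.im 0 := by
      simpa using ((hasDerivAt_id (0 : ℝ)).mul_const b.im).const_add a.im
    refine (((hr.pow 2).add (hi.pow 2)).const_sub 1).congr_deriv ?_
    simp
    ring
  have h2 : (fun τ : ℝ => rho (a + τ * b))
      = fun τ : ℝ => Real.sqrt (1 - ((a.re + τ * b.re) ^ 2 + (a.im + τ * b.im) ^ 2)) := by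
    ext τ
    rw [rho, ← Complex.normSq_eq_norm_sq, Complex.normSq_apply]
    simp [sq]
  have h0 : (1 : ℝ) - ((a.re + 0 * b.re) ^ 2 + (a.im + 0 * b.im) ^ 2) = 1 - ‖a‖ ^ 2 := by
    rw [← Complex.normSq_eq_norm_sq, Complex.normSq_apply]
    ring
  have hpos : 0 < 1 - ‖a‖ ^ 2 := by nlinarith [norm_nonneg a]
  rw [h2]
  have h3 := h1.sqrt (by rw [h0]; exact hpos.ne')
  rw [h0] at h3
  convert h3 using 1
  rw [rhoDeriv, rho]
  have := (Real.sqrt_pos.mpr hpos).ne'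
  field_simp

/-- The derivative of `factor p` at `α` in the direction `β`. -/
noncomputable def factorDeriv (p : ℕ) (α β : Fin n → ℂ) : Matrix (Fin n) (Fin n) ℂ :=
  blockDiag p (fun k => conj (β k)) (fun k => (rhoDeriv (α k) (β k) : ℂ))
    (fun k => (rhoDeriv (α k) (β k) : ℂ)) (fun k => -β k) 0

theorem hasDerivAt_factor (p : ℕ) {α β : Fin n → ℂ} (hα : IsVerblunsky α)
    (hβ : ∀ k : Fin n, (k : ℕ) + 1 = n → β k = 0) (i j : Fin n) :
    HasDerivAt (fun τ : ℝ => factor p (fun k => α k + τ * β k) i j) (factorDeriv p α β i j) 0 := by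
  have hid : HasDerivAt (fun τ : ℝ => (τ : ℂ)) 1 0 := Complex.ofRealCLM.hasDerivAt
  have h1 : ∀ k, HasDerivAt (fun τ : ℝ => α k + τ * β k) (β k) 0 := fun k => by
    simpa using (hid.mul_const (β k)).const_add (α k)
  have h2 : ∀ k, HasDerivAt (fun τ : ℝ => conj (α k + τ * β k)) (conj (β k)) 0 := fun k =>
    Complex.conjCLE.toContinuousLinearMap.hasFDerivAt.comp_hasDerivAt (0 : ℝ) (h1 k)
  have h3 : ∀ k, HasDerivAt (fun τ : ℝ => (rho (α k + τ * β k) : ℂ))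
      (rhoDeriv (α k) (β k) : ℂ) 0 := fun k => by
    rcases lt_or_eq_of_le (Nat.succ_le_of_lt k.isLt) with hk | hk
    · exact (hasDerivAt_rho (hα.1 k hk) (β k)).ofReal_comp
    -- At the last index `‖α k‖ = 1`, where the square root is singular, but `β k = 0` makes the
    -- curve constant.
    · simpa [hβ k hk, rhoDeriv] using hasDerivAt_const (0 : ℝ) (rho (α k) : ℂ)
  simp only [factor, factorDeriv, blockDiag, of_apply]
  split_ifs
  · exact h2 i
  · exact hasDerivAt_const _ _
  · exact (h1 _).neg
  · exact h3 i
  · exact h3 j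
  · exact hasDerivAt_const _ _

/-- A block unitary conjugation of a lower triangular matrix only creates new entries inside the
blocks. -/
theorem skewPart_conj_blockDiag {p : ℕ} (hp : p < 2) (a b c d : Fin n → ℂ) (e : ℂ)
    {K : Matrix (Fin n) (Fin n) ℂ} (hK : ∀ i j, i < j → K i j = 0) (hK' : ∀ i, (K i i).im = 0)
    {W : Matrix (Fin n) (Fin n) ℂ}
    (hW : W = blockDiag p a b c d e * K * (blockDiag p a b c d e)ᴴ) :
    skewPart W = blockDiag p
      (fun k => if (k : ℕ) + 1 = n then 0 else ((W k k).im : ℂ) * Complex.I)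
      (fun k => if h : (k : ℕ) + 1 < n then W k ⟨k + 1, h⟩ else 0)
      (fun k => if h : (k : ℕ) + 1 < n then -conj (W k ⟨k + 1, h⟩) else 0)
      (fun k => if h : (k : ℕ) + 1 < n then
        ((W ⟨k + 1, h⟩ ⟨k + 1, h⟩).im : ℂ) * Complex.I else 0) 0 := by
  have hWs : ∀ i j, W i j = ∑ l, ∑ m, blockDiag p a b c d e i m * K m l
      * conj (blockDiag p a b c d e j l) := by
    intro i j
    rw [hW, mul_apply]
    refine Finset.sum_congr rfl fun l _ => ?_
    rw [mul_apply, Finset.sum_mul]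
    rfl
  have hsupp : ∀ i j : Fin n, blockDiag p a b c d e i j ≠ 0 →
      i = j ∨ ((i : ℕ) + 1 = j ∧ (i : ℕ) % 2 = p) ∨ ((j : ℕ) + 1 = i ∧ (j : ℕ) % 2 = p) := by
    intro i j h
    by_contra! h'
    exact h (blockDiag_eq_zero _ _ _ _ _ h'.1 (fun hh => h'.2.1 hh.1 hh.2)
      (fun hh => h'.2.2 hh.1 hh.2))
  have hupper : ∀ i j : Fin n, i < j → ¬((i : ℕ) + 1 = j ∧ (i : ℕ) % 2 = p) → W i j = 0 := by
    intro i j hij hb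
    rw [hWs]
    refine Finset.sum_eq_zero fun l _ => Finset.sum_eq_zero fun m _ => ?_
    by_cases h1 : blockDiag p a b c d e i m = 0
    · simp [h1]
    by_cases h2 : blockDiag p a b c d e j l = 0
    · simp [h2]
    -- If `i < j` lie in different blocks, the whole block of `i` precedes that of `j`, so `K m l`
    -- is strictly above the diagonal.
    have h3 : m < l := by
      have hij' : (i : ℕ) < j := hij
      rw [Fin.lt_def]
      rcases hsupp _ _ h1 with rfl | ⟨h3, h3'⟩ | ⟨h3, h3'⟩ <;>
      rcases hsupp _ _ h2 with rfl | ⟨h4, h4'⟩ | ⟨h4, h4'⟩ <;> omega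
    simp [hK m l h3]
  have hdiag : ∀ i : Fin n, (∀ m, m ≠ i → blockDiag p a b c d e i m = 0) → (W i i).im = 0 := by
    intro i h
    have : W i i = (K i i) * (blockDiag p a b c d e i i * conj (blockDiag p a b c d e i i)) := by
      rw [hWs, Fintype.sum_eq_single i, Fintype.sum_eq_single i]
      · ring
      · intro m hm
        simp [h m hm]
      · intro l hl
        simp [h l hl]
    rw [this, Complex.mul_conj]
    simp [hK']
  ext i j
  rcases lt_trichotomy i j with h | rfl | h
  · have h' : (i : ℕ) < j := h
    by_cases hb : (i : ℕ) + 1 = j ∧ (i : ℕ) % 2 = p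
    · have hi : (i : ℕ) + 1 < n := by omega
      obtain rfl : j = ⟨i + 1, hi⟩ := Fin.ext hb.1.symm
      rw [blockDiag_head_tail _ _ _ _ _ hb.2]
      simp [skewPart, h, hi]
    · rw [blockDiag_eq_zero _ _ _ _ _ h.ne hb (by omega)]
      simp [skewPart, h, hupper i j h hb]
  · have hs : skewPart W i i = ((W i i).im : ℂ) * Complex.I := by simp [skewPart]
    rw [hs]
    rcases index_cases hp i with ⟨hi, hi'⟩ | ⟨hi', hi⟩ | ⟨hi, hi'⟩ | ⟨k, hk, hk', rfl⟩
    · rw [blockDiag_head_head _ _ _ _ _ hi', if_neg hi.ne]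
    · rw [blockDiag_head_head _ _ _ _ _ hi', if_pos hi, hdiag i, Complex.ofReal_zero, zero_mul]
      intro m hm
      have := m.isLt
      have hm' : (m : ℕ) ≠ i := fun h => hm (Fin.ext h)
      exact blockDiag_eq_zero _ _ _ _ _ hm.symm (by omega) (by omega)
    · rw [blockDiag_first _ _ _ _ _ hi hi', hdiag i, Complex.ofReal_zero, zero_mul]
      intro m hm
      exact blockDiag_eq_zero _ _ _ _ _ hm.symm (by omega) (by omega)
    · rw [blockDiag_tail_tail _ _ _ _ _ hk', dif_pos hk]
  · have h' : (j : ℕ) < i := h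
    by_cases hb : (j : ℕ) + 1 = i ∧ (j : ℕ) % 2 = p
    · have hj : (j : ℕ) + 1 < n := by omega
      obtain rfl : i = ⟨j + 1, hj⟩ := Fin.ext hb.1.symm
      rw [blockDiag_tail_head _ _ _ _ _ hb.2]
      simp [skewPart, h, h.not_gt, hj]
    · rw [blockDiag_eq_zero _ _ _ _ _ h.ne' (by omega) hb]
      simp [skewPart, h, h.not_gt, hupper j i h hb]

/-- For one block, `W = Ξ K Ξᴴ` with `K` lower triangular with real diagonal. Then `Im W₂₂ = -Im
W₁₁` and `Im (W₁₂ z) = r Im W₁₁`, which is what makes the skew part of `W` times `Ξ` a variation of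
`Ξ`, with the upper left entry in the role of `conj β`. -/
theorem block_identities {r : ℝ} {z A D c W₁₁ W₁₂ W₂₂ : ℂ} (hr0 : r ≠ 0)
    (hr : (r : ℂ) * r = 1 - z * conj z) (hA : A.im = 0) (hD : D.im = 0)
    (h₁₁ : W₁₁ = conj z * conj (conj z * conj A + r * conj 0)
      + r * conj (conj z * conj c + r * conj D))
    (h₁₂ : W₁₂ = conj z * conj (r * conj A + -z * conj 0)
      + r * conj (r * conj c + -z * conj D))
    (h₂₂ : W₂₂ = r * conj (r * conj A + -z * conj 0) + -z * conj (r * conj c + -z * conj D)) :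
    (W₁₁.im : ℂ) * Complex.I * conj z + W₁₂ * r
        = conj (conj ((W₁₁.im : ℂ) * Complex.I * conj z + W₁₂ * r)) ∧
      (W₁₁.im : ℂ) * Complex.I * r + W₁₂ * -z
        = ((-(conj z * conj ((W₁₁.im : ℂ) * Complex.I * conj z + W₁₂ * r)).re / r : ℝ) : ℂ) ∧
      -conj W₁₂ * conj z + (W₂₂.im : ℂ) * Complex.I * r
        = ((-(conj z * conj ((W₁₁.im : ℂ) * Complex.I * conj z + W₁₂ * r)).re / r : ℝ) : ℂ) ∧
      -conj W₁₂ * r + (W₂₂.im : ℂ) * Complex.I * -z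
        = -conj ((W₁₁.im : ℂ) * Complex.I * conj z + W₁₂ * r) := by
  have hr' : r * r = 1 - (z.re * z.re + z.im * z.im) := by
    simpa using congrArg Complex.re hr
  have e₁ : W₁₁.im = r * (c.re * z.im + c.im * z.re) := by
    rw [h₁₁]
    simp [hA, hD]
    ring
  have e₂ : W₁₂.re = r * ((A.re - D.re) * z.re + c.re * r) := by
    rw [h₁₂]
    simp [hA, hD]
    ring
  have e₃ : W₁₂.im = r * (-(A.re - D.re) * z.im + c.im * r) := by
    rw [h₁₂]
    simp [hA, hD]
    ring
  have e₄ : W₂₂.im = -(r * (c.re * z.im + c.im * z.re)) := by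
    rw [h₂₂]
    simp [hA, hD]
    ring
  clear h₁₁ h₁₂ h₂₂ hr
  -- The diagonal term contributes the purely imaginary `i Im W₁₁ |z|²` and drops out of the real
  -- part.
  have h : -(conj z * conj ((W₁₁.im : ℂ) * Complex.I * conj z + W₁₂ * r)).re / r
      = -(W₁₂ * z).re := by
    rw [div_eq_iff hr0]
    simp
    ring
  rw [h]
  refine ⟨by simp, ?_, ?_, ?_⟩ <;> apply Complex.ext <;> simp [e₁, e₂, e₃, e₄] <;> ring

theorem exists_hamiltonian_factor {p : ℕ} (hp : p < 2) {α : Fin n → ℂ} (hα : IsVerblunsky α)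
    (G : Matrix (Fin n) (Fin n) ℂ) :
    ∃ β : Fin n → ℂ, (∀ k : Fin n, (k : ℕ) + 1 = n → β k = 0) ∧
      hamiltonian (factor p α) G = factorDeriv p α β := by
  obtain ⟨hK, hK'⟩ := lowerPart_lower (G * factor p α)
  have hham := hamiltonian_of_unitary (factor_conjTranspose_mul hp hα) G
  set K := lowerPart (G * factor p α) with hKdef
  clear_value K
  rw [hham]
  generalize hW : factor p α * K * (factor p α)ᴴ = W
  rw [factor_eq_blockDiag] at hW
  rw [skewPart_conj_blockDiag hp _ _ _ _ _ hK hK' hW.symm, factor_eq_blockDiag,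
    blockDiag_mul hp _ _ _ _ _ _ _ _ _ _ (fun k hk => by simp [hk])]
  -- `V k` is the upper left entry of the product block and must equal `conj (β k)`. At the last
  -- index it vanishes, so the last Verblunsky coefficient does not move.
  set V : Fin n → ℂ := fun k => if h : (k : ℕ) + 1 < n then
    ((W k k).im : ℂ) * Complex.I * conj (α k) + W k ⟨k + 1, h⟩ * rho (α k) else 0 with hV
  refine ⟨fun k => conj (V k), fun k hk => by simp [hV, hk], ?_⟩
  have hWmul : ∀ i j, W i j = ∑ m, blockDiag p (fun k => conj (α k)) (fun k => (rho (α k) : ℂ))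
      (fun k => (rho (α k) : ℂ)) (fun k => -α k) 1 i m * conj (∑ l, blockDiag p
        (fun k => conj (α k)) (fun k => (rho (α k) : ℂ)) (fun k => (rho (α k) : ℂ))
        (fun k => -α k) 1 j l * conj (K m l)) := by
    intro i j
    rw [← hW, mul_assoc, mul_apply]
    refine Finset.sum_congr rfl fun m _ => ?_
    rw [mul_apply, map_sum]
    congr 1
    refine Finset.sum_congr rfl fun l _ => ?_
    rw [mul_comm, map_mul, Complex.conj_conj]
    rfl
  apply blockDiag_congr hp
  · intro k hk hk'
    have hlt : k < (⟨k + 1, hk'⟩ : Fin n) := by simp [Fin.lt_def]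
    have hW11 := hWmul k k
    have hW12 := hWmul k ⟨k + 1, hk'⟩
    have hW22 := hWmul ⟨k + 1, hk'⟩ ⟨k + 1, hk'⟩
    simp only [sum_blockDiag_head _ _ _ _ _ hk hk', sum_blockDiag_tail _ _ _ _ _ hk hk',
      hK _ _ hlt] at hW11 hW12 hW22
    have hVk : V k = ((W k k).im : ℂ) * Complex.I * conj (α k) + W k ⟨k + 1, hk'⟩ * rho (α k) := by
      simp [hV, hk']
    simp only [hVk, hk', hk'.ne, dif_pos, if_false, rhoDeriv]
    have hr := rho_sq (hα.norm_le k)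
    have hr0 := (rho_pos (hα.1 k hk')).ne'
    have ha := hK' k
    have hd := hK' ⟨k + 1, hk'⟩
    generalize W k k = W11 at *
    generalize W k ⟨k + 1, hk'⟩ = W12 at *
    generalize W ⟨k + 1, hk'⟩ ⟨k + 1, hk'⟩ = W22 at *
    generalize K k k = A at *
    generalize K ⟨k + 1, hk'⟩ ⟨k + 1, hk'⟩ = D at *
    generalize K ⟨k + 1, hk'⟩ k = c at *
    generalize rho (α k) = r at *
    generalize α k = z at *
    exact block_identities hr0 hr ha hd hW11 hW12 hW22
  · intro k hk hk'
    simp [hV, hk']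
  · simp

/-! ### Curves of CMV matrices. -/

theorem hasDerivAt_matrix {f : ℝ → Matrix (Fin n) (Fin n) ℂ} {f' : Matrix (Fin n) (Fin n) ℂ}
    {x : ℝ} : HasDerivAt f f' x ↔ ∀ i j, HasDerivAt (fun t => f t i j) (f' i j) x := by
  refine (hasDerivAt_pi (φ := f)).trans (forall_congr' fun i => ?_)
  exact hasDerivAt_pi (φ := fun t => f t i)

theorem _root_.HasDerivAt.matrix_mul {f g : ℝ → Matrix (Fin n) (Fin n) ℂ}
    {f' g' : Matrix (Fin n) (Fin n) ℂ} {x : ℝ} (hf : HasDerivAt f f' x) (hg : HasDerivAt g g' x) :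
    HasDerivAt (fun t => f t * g t) (f' * g x + f x * g') x := by
  rw [hasDerivAt_matrix] at hf hg ⊢
  intro i j
  simp only [mul_apply, Matrix.add_apply, ← Finset.sum_add_distrib]
  exact HasDerivAt.fun_sum fun k _ => (hf i k).mul (hg k j)

theorem eventually_isVerblunsky {α β : Fin n → ℂ} (hα : IsVerblunsky α)
    (hβ : ∀ k : Fin n, (k : ℕ) + 1 = n → β k = 0) :
    ∀ᶠ τ : ℝ in 𝓝 0, IsVerblunsky fun k => α k + τ * β k := by
  have h : ∀ᶠ τ : ℝ in 𝓝 0, ∀ k : Fin n, (k : ℕ) + 1 < n → ‖α k + τ * β k‖ < 1 := by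
    rw [eventually_all]
    intro k
    by_cases hk : (k : ℕ) + 1 < n
    · have hc : Continuous fun τ : ℝ => ‖α k + τ * β k‖ := by fun_prop
      filter_upwards [hc.continuousAt.eventually_lt_const (by simpa using hα.1 k hk)] with τ hτ _
      exact hτ
    · exact Eventually.of_forall fun τ h => absurd h hk
  filter_upwards [h] with τ hτ
  exact ⟨hτ, fun k hk => by simpa [hβ k hk] using hα.2 k hk⟩

/-- Every Hamiltonian vector at a CMV matrix is the velocity of a curve of CMV matrices. -/
theorem exists_curve {X : Matrix (Fin n) (Fin n) ℂ} (hX : X ∈ cmvSet n)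
    (G : Matrix (Fin n) (Fin n) ℂ) :
    ∃ γ : ℝ → Matrix (Fin n) (Fin n) ℂ, γ 0 = X ∧ HasDerivAt γ (hamiltonian X G) 0 ∧
      ∀ᶠ τ in 𝓝 0, γ τ ∈ cmvSet n := by
  obtain ⟨α, hα, rfl⟩ := hX
  obtain ⟨β₀, h₀, hβ₀⟩ := exists_hamiltonian_factor (p := 0) (by norm_num) hα (factor 1 α * G)
  obtain ⟨β₁, h₁, hβ₁⟩ := exists_hamiltonian_factor (p := 1) (by norm_num) hα (G * factor 0 α)
  -- The two factors involve coefficients of opposite parity, so their variations merge into a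
  -- single direction.
  set β : Fin n → ℂ := fun k => if (k : ℕ) % 2 = 0 then β₀ k else β₁ k with hβdef
  have hβ : ∀ k : Fin n, (k : ℕ) + 1 = n → β k = 0 := fun k hk => by
    simp [hβdef, h₀ k hk, h₁ k hk]
  have e₀ : factorDeriv 0 α β₀ = factorDeriv 0 α β :=
    blockDiag_congr (by norm_num) (fun k hk _ => by simp [hβdef, hk])
      (fun k hk _ => by simp [hβdef, hk]) rfl
  have e₁ : factorDeriv 1 α β₁ = factorDeriv 1 α β :=
    blockDiag_congr (by norm_num) (fun k hk _ => by simp [hβdef, hk])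
      (fun k hk _ => by simp [hβdef, hk]) rfl
  refine ⟨fun τ => cmvMatrix fun k => α k + τ * β k, by simp, ?_, ?_⟩
  · rw [cmvMatrix, hamiltonian_mul, hβ₀, hβ₁, e₀, e₁]
    have h := (hasDerivAt_matrix.mpr (hasDerivAt_factor 0 hα hβ)).matrix_mul
      (hasDerivAt_matrix.mpr (hasDerivAt_factor 1 hα hβ))
    simpa [cmvMatrix] using h
  · filter_upwards [eventually_isVerblunsky hα hβ] with τ hτ
    exact ⟨_, hτ, rfl⟩

end CMV

section Isometry

open Module.End InnerProductSpace

variable {E : Type*} [NormedAddCommGroup E] [InnerProductSpace ℂ E] {T : E →ₗ[ℂ] E}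

namespace CMV

/-! ### Unitary operators in finite dimension -/

theorem conj_mul_eigenvalue_of_isometry (hT : ∀ u v, inner ℂ (T u) (T v) = inner ℂ u v) {z : ℂ}
    {v : E} (hv : T v = z • v) (hv0 : v ≠ 0) : conj z * z = 1 := by
  have h := hT v v
  rw [hv, inner_smul_left, inner_smul_right, ← mul_assoc] at h
  exact mul_right_cancel₀ (inner_self_ne_zero.mpr hv0) (h.trans (one_mul _).symm)

theorem inner_eigenvectors_of_isometry (hT : ∀ u v, inner ℂ (T u) (T v) = inner ℂ u v) {z w : ℂ}
    {u v : E} (hu : T u = z • u) (hv : T v = w • v) (hzw : z ≠ w) : inner ℂ u v = 0 := by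
  by_cases hu0 : u = 0
  · simp [hu0]
  have hz := conj_mul_eigenvalue_of_isometry hT hu hu0
  have h := hT u v
  rw [hu, hv, inner_smul_left, inner_smul_right] at h
  by_contra h0
  have h1 : conj z * w = 1 := mul_right_cancel₀ h0 (by rw [mul_assoc, h, one_mul])
  have h2 : conj z ≠ 0 := left_ne_zero_of_mul (by rw [h1]; exact one_ne_zero)
  exact hzw (mul_left_cancel₀ h2 (hz.trans h1.symm))

/-- The complement is invariant, so if it were nonzero it would contain an eigenvector of `T`, which
lies in an eigenspace orthogonal to it. -/
theorem orthogonalComplement_iSup_eigenspaces_of_isometry [FiniteDimensional ℂ E]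
    (hT : ∀ u v, inner ℂ (T u) (T v) = inner ℂ u v) : (⨆ z, eigenspace T z)ᗮ = ⊥ := by
  have hinv : ∀ v ∈ (⨆ z, eigenspace T z)ᗮ, T v ∈ (⨆ z, eigenspace T z)ᗮ := by
    rw [← Submodule.iInf_orthogonal]
    refine T.iInf_invariant fun z v hv w hw => ?_
    rw [mem_eigenspace_iff] at hw
    by_cases hw0 : w = 0
    · simp [hw0]
    have hz := conj_mul_eigenvalue_of_isometry hT hw hw0
    have hz0 : z ≠ 0 := right_ne_zero_of_mul (by rw [hz]; exact one_ne_zero)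
    have : w = T (z⁻¹ • w) := by rw [map_smul, hw, smul_smul, inv_mul_cancel₀ hz0, one_smul]
    rw [this, hT]
    exact hv _ (Submodule.smul_mem _ _ (mem_eigenspace_iff.mpr hw))
  by_contra h
  have : Nontrivial ((⨆ z, eigenspace T z)ᗮ : Submodule ℂ E) := Submodule.nontrivial_iff_ne_bot.mpr h
  obtain ⟨z, hz⟩ := exists_eigenvalue (T.restrict hinv)
  refine hz (eigenspace_restrict_eq_bot hinv ?_)
  exact ((Submodule.isOrtho_orthogonal_right _).mono_left (le_iSup _ z)).disjoint

theorem exists_eigenbasis_of_isometry [FiniteDimensional ℂ E] {n : ℕ}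
    (hn : Module.finrank ℂ E = n) (hT : ∀ u v, inner ℂ (T u) (T v) = inner ℂ u v) :
    ∃ (b : OrthonormalBasis (Fin n) ℂ E) (z : Fin n → ℂ), ∀ j, T (b j) = z j • b j := by
  have hV : OrthogonalFamily ℂ (fun z : Eigenvalues T => eigenspace T z) fun z =>
      (eigenspace T z).subtypeₗᵢ := by
    rintro z w hzw ⟨u, hu⟩ ⟨v, hv⟩
    exact inner_eigenvectors_of_isometry hT (mem_eigenspace_iff.mp hu) (mem_eigenspace_iff.mp hv)
      (fun h => hzw (Subtype.ext h))
  have hI : DirectSum.IsInternal fun z : Eigenvalues T => eigenspace T z := by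
    refine hV.isInternal_iff.mpr ?_
    change (⨆ z : { z // eigenspace T z ≠ ⊥ }, eigenspace T z)ᗮ = ⊥
    rw [iSup_ne_bot_subtype, orthogonalComplement_iSup_eigenspaces_of_isometry hT]
  exact ⟨hI.subordinateOrthonormalBasis hn hV,
    fun j => (hI.subordinateOrthonormalBasisIndex hn j hV : Eigenvalues T),
    fun j => mem_eigenspace_iff.mp (hI.subordinateOrthonormalBasis_subordinate hn j hV)⟩

/-- Eigenvectors for distinct eigenvalues are orthogonal, so normalising suffices. Unlike
`exists_eigenbasis_of_isometry`, the labelling `z` is prescribed. -/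
theorem exists_eigenbasis_of_injective [FiniteDimensional ℂ E] {n : ℕ}
    (hn : Module.finrank ℂ E = n) (hT : ∀ u v, inner ℂ (T u) (T v) = inner ℂ u v)
    {z : Fin n → ℂ} (hz : Function.Injective z) {w : Fin n → E} (hw : ∀ j, w j ≠ 0)
    (hTw : ∀ j, T (w j) = z j • w j) :
    ∃ b : OrthonormalBasis (Fin n) ℂ E, ∀ j, T (b j) = z j • b j := by
  have ho : Orthonormal ℂ fun j => ((‖w j‖⁻¹ : ℝ) : ℂ) • w j := by
    refine ⟨fun j => ?_, fun j k hjk => ?_⟩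
    · have := norm_ne_zero_iff.mpr (hw j)
      rw [norm_smul, Complex.norm_real, norm_inv, norm_norm, inv_mul_cancel₀ this]
    · change inner ℂ (((‖w j‖⁻¹ : ℝ) : ℂ) • w j) (((‖w k‖⁻¹ : ℝ) : ℂ) • w k) = 0
      rw [inner_smul_left, inner_smul_right,
        inner_eigenvectors_of_isometry hT (hTw j) (hTw k) (hz.ne hjk)]
      simp
  obtain ⟨b, hb⟩ := Orthonormal.exists_orthonormalBasis_extension_of_card_eq
    (𝕜 := ℂ) (E := E) (ι := Fin n) (by simpa using hn)
    (v := fun j => ((‖w j‖⁻¹ : ℝ) : ℂ) • w j) (s := Set.univ)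
    (ho.comp _ Subtype.val_injective)
  refine ⟨b, fun j => ?_⟩
  rw [hb j (Set.mem_univ j), map_smul, hTw, smul_comm]

end CMV

end Isometry

namespace CMV

variable {n : ℕ}

/-! ### Cyclicity of the first basis vector and simplicity of the spectrum. -/

theorem inner_mulVec_of_unitary {X : Matrix (Fin n) (Fin n) ℂ} (hX : Xᴴ * X = 1)
    (u v : EuclideanSpace ℂ (Fin n)) :
    inner ℂ (Matrix.toEuclideanLin X u) (Matrix.toEuclideanLin X v) = inner ℂ u v := by
  rw [EuclideanSpace.inner_eq_star_dotProduct, EuclideanSpace.inner_eq_star_dotProduct]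
  change (X *ᵥ v.ofLp) ⬝ᵥ star (X *ᵥ u.ofLp) = _
  rw [star_mulVec, dotProduct_comm,
    ← dotProduct_mulVec, mulVec_mulVec, hX, one_mulVec, dotProduct_comm]

theorem toEuclideanLin_eq_smul_iff {X : Matrix (Fin n) (Fin n) ℂ} {z : ℂ}
    {v : EuclideanSpace ℂ (Fin n)} :
    Matrix.toEuclideanLin X v = z • v ↔ X *ᵥ v.ofLp = z • v.ofLp := by
  rw [← (WithLp.ofLp_injective 2).eq_iff]
  rfl

/-- The vector `e₁` is cyclic for a CMV matrix. -/
theorem cmvMatrix_eigenvector_ne_zero [NeZero n] {α : Fin n → ℂ} (hα : IsVerblunsky α) {z : ℂ}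
    (hz : z ≠ 0) {v : Fin n → ℂ} (hv : cmvMatrix α *ᵥ v = z • v) (h0 : v 0 = 0) : v = 0 := by
  set u := factor 1 α *ᵥ v with hu
  have hu' : ∀ i, ∑ j, factor 1 α i j * v j = u i := fun i => rfl
  have hLu : ∀ i, ∑ j, factor 0 α i j * u j = z * v i := by
    intro i
    rw [cmvMatrix, ← mulVec_mulVec, ← hu] at hv
    exact congrFun hv i
  simp only [factor_eq_blockDiag] at hu' hLu
  -- Zeros propagate through `ℳ v = u` and `ℒ u = z v`. The block `Ξ_k` belongs to `ℒ` for even `k`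
  -- and to `ℳ` for odd `k`; since `ρ_k > 0`, its first row gives one new zero and its second row
  -- the other.
  have key : ∀ (k : ℕ) (hk : k < n), v ⟨k, hk⟩ = 0 ∧ u ⟨k, hk⟩ = 0 := by
    intro k
    induction k with
    | zero =>
      intro hk
      have hv0 : v ⟨0, hk⟩ = 0 := h0
      refine ⟨hv0, ?_⟩
      rw [← hu', sum_blockDiag_first _ _ _ _ _ rfl (by simp), hv0, mul_zero]
    | succ k ih =>
      intro hk
      obtain ⟨hvk, huk⟩ := ih (by omega)
      set i : Fin n := ⟨k, by omega⟩ with hi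
      have hρ : (rho (α i) : ℂ) ≠ 0 := Complex.ofReal_ne_zero.mpr (rho_pos (hα.1 i hk)).ne'
      change v ⟨(i : ℕ) + 1, hk⟩ = 0 ∧ u ⟨(i : ℕ) + 1, hk⟩ = 0
      rcases Nat.mod_two_eq_zero_or_one k with hp | hp
      · have h1 := hLu i
        have h2 := hLu ⟨(i : ℕ) + 1, hk⟩
        rw [sum_blockDiag_head _ _ _ _ _ hp hk, hvk, huk] at h1
        rw [sum_blockDiag_tail _ _ _ _ _ hp hk, huk] at h2
        have h3 : u ⟨(i : ℕ) + 1, hk⟩ = 0 := by simpa [hρ] using h1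
        rw [h3] at h2
        exact ⟨by simpa [hz] using h2.symm, h3⟩
      · have h1 := hu' i
        have h2 := hu' ⟨(i : ℕ) + 1, hk⟩
        rw [sum_blockDiag_head _ _ _ _ _ hp hk, hvk, huk] at h1
        rw [sum_blockDiag_tail _ _ _ _ _ hp hk, hvk] at h2
        have h3 : v ⟨(i : ℕ) + 1, hk⟩ = 0 := by simpa [hρ] using h1
        rw [h3] at h2
        exact ⟨h3, by simpa using h2.symm⟩
  ext i
  exact (key i i.isLt).1

theorem conjTranspose_mul_of_mem_cmvSet {X : Matrix (Fin n) (Fin n) ℂ} (hX : X ∈ cmvSet n) :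
    Xᴴ * X = 1 := by
  obtain ⟨α, hα, rfl⟩ := hX
  exact cmvMatrix_conjTranspose_mul hα

/-- A CMV matrix has simple spectrum. -/
theorem exists_isSpectralData [NeZero n] {X : Matrix (Fin n) (Fin n) ℂ} (hX : X ∈ cmvSet n) :
    ∃ z μ : Fin n → ℂ, IsSpectralData X z μ := by
  have hT := inner_mulVec_of_unitary (conjTranspose_mul_of_mem_cmvSet hX)
  obtain ⟨α, hα, rfl⟩ := hX
  obtain ⟨b, z, hb⟩ := exists_eigenbasis_of_isometry finrank_euclideanSpace_fin hT
  refine ⟨z, _, fun j k hjk => ?_, b, fun j => ⟨toEuclideanLin_eq_smul_iff.mp (hb j), rfl⟩⟩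
  by_contra hne
  have hb0 : ∀ j, b j ≠ 0 := fun j h => by simpa [h] using b.norm_eq_one j
  have hz0 : z j ≠ 0 := right_ne_zero_of_mul (a := conj (z j))
    (by rw [conj_mul_eigenvalue_of_isometry hT (hb j) (hb0 j)]; exact one_ne_zero)
  have hfirst : ∀ j, z j ≠ 0 → b j 0 ≠ 0 := by
    intro j hz h
    refine hb0 j (WithLp.ofLp_injective 2 ?_)
    exact cmvMatrix_eigenvector_ne_zero hα hz (toEuclideanLin_eq_smul_iff.mp (hb j)) h
  -- Two independent eigenvectors for one eigenvalue have a nontrivial combination with first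
  -- coordinate zero, contradicting cyclicity.
  set w : EuclideanSpace ℂ (Fin n) := b k 0 • b j - b j 0 • b k with hw
  have hTw : Matrix.toEuclideanLin (cmvMatrix α) w = z j • w := by
    rw [hw, map_sub, map_smul, map_smul, hb j, hb k, ← hjk, smul_sub, smul_comm (z j), smul_comm (z j)]
  have hw0 : w = 0 := by
    refine WithLp.ofLp_injective 2 ?_
    refine cmvMatrix_eigenvector_ne_zero hα hz0 (toEuclideanLin_eq_smul_iff.mp hTw) ?_
    simp [hw, mul_comm]
  have h := congrArg (inner ℂ (b j)) hw0
  rw [hw, inner_sub_right, inner_smul_right, inner_smul_right, b.inner_eq_one, b.inner_eq_zero hne,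
    inner_zero_right] at h
  exact hfirst k (hjk ▸ hz0) (by simpa using h)

/-! ### Spectral resolutions -/

/-- `P j` are the eigenprojections of the unitary matrix `X` with simple eigenvalues `z j`. -/
structure IsSpectralResolution (X : Matrix (Fin n) (Fin n) ℂ) (z : Fin n → ℂ)
    (P : Fin n → Matrix (Fin n) (Fin n) ℂ) : Prop where
  injective : Function.Injective z
  conj_mul : ∀ j, conj (z j) * z j = 1
  mul_self : ∀ j, P j * P j = P j
  mul_of_ne : ∀ j k, j ≠ k → P j * P k = 0
  sum_eq : ∑ j, P j = 1
  herm : ∀ j, (P j)ᴴ = P j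
  trace_eq : ∀ j, trace (P j) = 1
  mul_left : ∀ j, X * P j = z j • P j
  mul_right : ∀ j, P j * X = z j • P j

theorem IsSpectralData.exists_resolution [NeZero n] {X : Matrix (Fin n) (Fin n) ℂ}
    (hX : Xᴴ * X = 1) {z μ : Fin n → ℂ} (h : IsSpectralData X z μ) :
    ∃ P, IsSpectralResolution X z P ∧ ∀ j, P j 0 0 = μ j := by
  obtain ⟨hz, v, hv⟩ := h
  have hT := inner_mulVec_of_unitary hX
  have hTv : ∀ j, Matrix.toEuclideanLin X (v j) = z j • v j := fun j =>
    toEuclideanLin_eq_smul_iff.mpr (hv j).1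
  have hv0 : ∀ j, v j ≠ 0 := fun j h => by simpa [h] using v.norm_eq_one j
  have hzz := fun j => conj_mul_eigenvalue_of_isometry hT (hTv j) (hv0 j)
  have hdot : ∀ j k, star (v j).ofLp ⬝ᵥ (v k).ofLp = if j = k then 1 else 0 := fun j k => by
    rw [dotProduct_comm, ← EuclideanSpace.inner_eq_star_dotProduct]
    exact orthonormal_iff_ite.mp v.orthonormal j k
  have hleft : ∀ j, X * vecMulVec (v j).ofLp (star (v j).ofLp)
      = z j • vecMulVec (v j).ofLp (star (v j).ofLp) := fun j => by
    rw [mul_vecMulVec, (hv j).1, smul_vecMulVec]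
  have hherm : ∀ j, (vecMulVec (v j).ofLp (star (v j).ofLp))ᴴ
      = vecMulVec (v j).ofLp (star (v j).ofLp) := fun j => by
    rw [conjTranspose_vecMulVec, star_star]
  refine ⟨fun j => vecMulVec (v j).ofLp (star (v j).ofLp), ⟨hz, hzz, fun j => ?_,
    fun j k hjk => ?_, ?_, hherm, fun j => ?_, hleft, fun j => ?_⟩, fun j => ?_⟩
  · rw [vecMulVec_mul_vecMulVec, hdot, if_pos rfl, one_smul]
  · rw [vecMulVec_mul_vecMulVec, hdot, if_neg hjk]
    simp
  · ext i k
    have := congrArg (fun w : EuclideanSpace ℂ (Fin n) => w i)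
      (v.sum_repr' (EuclideanSpace.single k (1 : ℂ)))
    simp only [Matrix.sum_apply, vecMulVec_apply]
    rw [Matrix.one_apply]
    simpa [mul_comm, EuclideanSpace.inner_single_right, Pi.single_apply] using this
  · rw [trace_vecMulVec, dotProduct_comm, hdot, if_pos rfl]
  -- The adjoint of `X P = z P` is `P Xᴴ = conj z P`; multiplying by `X` on the right and by `z`
  -- gives `P X = z P`.
  · have h1 := congrArg conjTranspose (hleft j)
    rw [conjTranspose_mul, conjTranspose_smul, hherm] at h1
    have h2 := congrArg (fun Y => z j • (Y * X)) h1
    simp only [mul_assoc, hX, mul_one, smul_mul_assoc, smul_smul] at h2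
    rw [h2, mul_comm (z j), ← starRingEnd_apply (z j), hzz, one_smul]
  · beta_reduce
    rw [(hv j).2, vecMulVec_apply, Pi.star_apply, ← starRingEnd_apply, Complex.mul_conj,
      Complex.normSq_eq_norm_sq]

/-! ### Lagrange interpolation of the eigenprojections -/

/-- The Lagrange interpolation polynomial at the nodes `z`, evaluated at the matrix `X`. -/
noncomputable def lagrange (X : Matrix (Fin n) (Fin n) ℂ) (z : Fin n → ℂ) (t : Fin n) :
    Matrix (Fin n) (Fin n) ℂ :=
  ((Finset.univ.erase t).toList.map fun k => (z t - z k)⁻¹ • (X - z k • 1)).prod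

/-- On the range of `P j` the polynomial acts as its value at `z j`, which is `1` for `j = t` and
`0` otherwise. This expresses the projections smoothly through `X` and its eigenvalues, by a formula
that also makes sense off the CMV set. -/
theorem IsSpectralResolution.lagrange_eq {X : Matrix (Fin n) (Fin n) ℂ} {z : Fin n → ℂ}
    {P : Fin n → Matrix (Fin n) (Fin n) ℂ} (h : IsSpectralResolution X z P) (t : Fin n) :
    lagrange X z t = P t := by
  have key : ∀ (l : List (Fin n)) (j : Fin n),
      (l.map fun k => (z t - z k)⁻¹ • (X - z k • 1)).prod * P j
        = (l.map fun k => (z t - z k)⁻¹ * (z j - z k)).prod • P j := by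
    intro l j
    induction l with
    | nil => simp
    | cons k l ih =>
      simp only [List.map_cons, List.prod_cons]
      rw [mul_assoc, ih, mul_smul_comm, smul_mul_assoc, sub_mul, h.mul_left, smul_mul_assoc,
        one_mul, ← sub_smul, smul_smul, smul_smul]
      congr 1
      ring
  have hsum : lagrange X z t = ∑ j, lagrange X z t * P j := by
    rw [← Finset.mul_sum, h.sum_eq, mul_one]
  rw [hsum, lagrange, Finset.sum_eq_single t]
  · rw [key, List.prod_eq_one, one_smul]
    intro x hx
    obtain ⟨k, hk, rfl⟩ := List.mem_map.mp hx
    have hk : k ≠ t := by simpa using hk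
    exact inv_mul_cancel₀ (sub_ne_zero.mpr (h.injective.ne hk.symm))
  · intro j _ hj
    rw [key, List.prod_eq_zero, zero_smul]
    exact List.mem_map.mpr ⟨j, by simpa using hj, by simp⟩
  · simp

section Smooth

variable {E : Type*} [NormedAddCommGroup E] [NormedSpace ℝ E] {m : WithTop ℕ∞} {x : E}

theorem contDiffAt_matrix {f : E → Matrix (Fin n) (Fin n) ℂ} :
    ContDiffAt ℝ m f x ↔ ∀ i j, ContDiffAt ℝ m (fun y => f y i j) x := by
  refine (contDiffAt_pi (Φ := f)).trans (forall_congr' fun i => ?_)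
  exact contDiffAt_pi (Φ := fun y => f y i)

theorem _root_.ContDiffAt.matrix_mul {f g : E → Matrix (Fin n) (Fin n) ℂ}
    (hf : ContDiffAt ℝ m f x) (hg : ContDiffAt ℝ m g x) :
    ContDiffAt ℝ m (fun y => f y * g y) x := by
  rw [contDiffAt_matrix] at hf hg ⊢
  intro i j
  simp only [mul_apply]
  exact ContDiffAt.sum fun k _ => (hf i k).mul (hg k j)

theorem contDiffAt_lagrange {f : E → Matrix (Fin n) (Fin n) ℂ} {z : Fin n → E → ℂ}
    (hf : ContDiffAt ℝ m f x) (hz : ∀ k, ContDiffAt ℝ m (z k) x)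
    (hinj : Function.Injective fun k => z k x) (t : Fin n) :
    ContDiffAt ℝ m (fun y => lagrange (f y) (fun k => z k y) t) x := by
  have key : ∀ l : List (Fin n), (∀ k ∈ l, k ≠ t) → ContDiffAt ℝ m
      (fun y => (l.map fun k => (z t y - z k y)⁻¹ • (f y - z k y • 1)).prod) x := by
    intro l
    induction l with
    | nil => exact fun _ => contDiffAt_const
    | cons k l ih =>
      intro hl
      simp only [List.map_cons, List.prod_cons]
      refine ContDiffAt.matrix_mul ?_ (ih fun j hj => hl j (List.mem_cons_of_mem _ hj))
      have hne : z t x - z k x ≠ 0 := sub_ne_zero.mpr (hinj.ne (hl k List.mem_cons_self).symm)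
      rw [contDiffAt_matrix] at hf ⊢
      intro i j
      simp only [Matrix.smul_apply, Matrix.sub_apply, smul_eq_mul]
      exact (((hz t).sub (hz k)).inv hne).mul ((hf i j).sub ((hz k).mul contDiffAt_const))
  exact key _ fun k hk => by simpa using hk

end Smooth

/-! ### Existence of smooth spectral data -/

theorem charpoly_eq_prod {X : Matrix (Fin n) (Fin n) ℂ} {z : Fin n → ℂ}
    (hz : Function.Injective z) {v : Fin n → Fin n → ℂ} (hv : ∀ j, v j ≠ 0)
    (hXv : ∀ j, X *ᵥ v j = z j • v j) :
    X.charpoly = ∏ j, (Polynomial.X - Polynomial.C (z j)) := by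
  have hroot : ∀ j, Polynomial.X - Polynomial.C (z j) ∣ X.charpoly := by
    intro j
    rw [Polynomial.dvd_iff_isRoot, Polynomial.IsRoot, eval_charpoly]
    refine exists_mulVec_eq_zero_iff.mp ⟨v j, hv j, ?_⟩
    rw [sub_mulVec, hXv, scalar_apply, ← smul_one_eq_diagonal, smul_mulVec, one_mulVec, sub_self]
  have hdvd : ∏ j, (Polynomial.X - Polynomial.C (z j)) ∣ X.charpoly :=
    Finset.prod_dvd_of_coprime (fun j _ k _ hjk => Polynomial.pairwise_coprime_X_sub_C hz hjk)
      (fun j _ => hroot j)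
  have hmonic : (∏ j, (Polynomial.X - Polynomial.C (z j))).Monic :=
    Polynomial.monic_prod_of_monic _ _ fun j _ => Polynomial.monic_X_sub_C _
  have hdeg : (∏ j, (Polynomial.X - Polynomial.C (z j))).natDegree = n := by
    rw [Polynomial.natDegree_prod_of_monic _ _ fun j _ => Polynomial.monic_X_sub_C _]
    simp
  have hdeg' : X.charpoly.natDegree = n := by
    rw [charpoly_natDegree_eq_dim, Fintype.card_fin]
  exact Polynomial.eq_of_monic_of_dvd_of_natDegree_le hmonic X.charpoly_monic hdvd
    (hdeg'.trans hdeg.symm).le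

theorem contDiff_det_sub {𝕜 : Type*} [RCLike 𝕜] [NormedAlgebra 𝕜 ℂ] (m : WithTop ℕ∞) :
    ContDiff 𝕜 m fun p : Matrix (Fin n) (Fin n) ℂ × ℂ => (p.2 • (1 : Matrix _ _ ℂ) - p.1).det := by
  simp only [det_apply', Matrix.sub_apply, Matrix.smul_apply]
  refine ContDiff.sum fun σ _ => contDiff_const.mul (contDiff_prod fun i _ => ?_)
  refine (contDiff_snd.smul contDiff_const).sub ?_
  have h1 : ContDiff 𝕜 m fun X : Matrix (Fin n) (Fin n) ℂ => X (σ i) :=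
    contDiff_apply 𝕜 (Fin n → ℂ) (σ i)
  have h2 : ContDiff 𝕜 m fun v : Fin n → ℂ => v i := contDiff_apply 𝕜 ℂ i
  exact (h2.comp h1).comp contDiff_fst

/-- The implicit function theorem applies to `det (w - Y) = 0` because a simple root has nonzero
derivative. -/
theorem exists_smooth_eigenvalue {X : Matrix (Fin n) (Fin n) ℂ} {z : Fin n → ℂ}
    (hz : Function.Injective z) (hX : X.charpoly = ∏ j, (Polynomial.X - Polynomial.C (z j)))
    (s : Fin n) : ∃ ζ : Matrix (Fin n) (Fin n) ℂ → ℂ, ContDiffAt ℝ ω ζ X ∧ ζ X = z s ∧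
      ∀ᶠ Y in 𝓝 X, (ζ Y • (1 : Matrix (Fin n) (Fin n) ℂ) - Y).det = 0 := by
  set f : Matrix (Fin n) (Fin n) ℂ × ℂ → ℂ := fun p => (p.2 • (1 : Matrix _ _ ℂ) - p.1).det with hf
  have hfX : ∀ w, f (X, w) = X.charpoly.eval w := fun w => by
    rw [eval_charpoly, scalar_apply, ← smul_one_eq_diagonal]
  have hf0 : f (X, z s) = 0 := by
    rw [hfX, hX, Polynomial.eval_prod]
    exact Finset.prod_eq_zero (Finset.mem_univ s) (by simp)
  have hcd : ContDiffAt ℂ ω f (X, z s) := (contDiff_det_sub ω).contDiffAt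
  have hder : (fderiv ℂ f (X, z s) ∘L .inr ℂ _ ℂ) 1 ≠ 0 := by
    have h1 : HasDerivAt (fun w => f (X, w)) ((fderiv ℂ f (X, z s) ∘L .inr ℂ _ ℂ) 1) (z s) := by
      have h2 : HasFDerivAt (fun w => f (X, w)) (fderiv ℂ f (X, z s) ∘L .inr ℂ _ ℂ) (z s) :=
        (hcd.differentiableAt (by simp)).hasFDerivAt.comp (z s) (hasFDerivAt_prodMk_right X (z s))
      exact h2.hasDerivAt
    simp only [hfX] at h1
    rw [h1.unique (Polynomial.hasDerivAt _ _), hX, ← Finset.mul_prod_erase _ _ (Finset.mem_univ s),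
      Polynomial.derivative_mul, Polynomial.eval_add, Polynomial.eval_mul, Polynomial.eval_mul]
    simp only [Polynomial.derivative_X_sub_C, Polynomial.eval_one, Polynomial.eval_sub,
      Polynomial.eval_X, Polynomial.eval_C, sub_self, zero_mul, one_mul, add_zero,
      Polynomial.eval_prod]
    exact Finset.prod_ne_zero_iff.mpr fun k hk =>
      sub_ne_zero.mpr (hz.ne (Finset.ne_of_mem_erase hk).symm)
  have hinv : (fderiv ℂ f (X, z s) ∘L .inr ℂ _ ℂ).IsInvertible := by
    refine ⟨ContinuousLinearEquiv.unitsEquivAut ℂ (Units.mk0 _ hder), ?_⟩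
    ext
    simp
  refine ⟨hcd.implicitFunction (by simp) hinv, ?_, hcd.implicitFunction_apply_self _ hinv, ?_⟩
  · exact (hcd.contDiffAt_implicitFunction (by simp) hinv).restrict_scalars ℝ
  · filter_upwards [hcd.eventually_apply_implicitFunction (by simp) hinv] with Y hY
    rw [hf0] at hY
    exact hY

theorem exists_isLocalSpectralFamily [NeZero n] {X : Matrix (Fin n) (Fin n) ℂ}
    (hX : X ∈ cmvSet n) : ∃ Z M, IsLocalSpectralFamily X Z M := by
  obtain ⟨z, μ, hz, v, hv⟩ := exists_isSpectralData hX
  have hv0 : ∀ j, (v j).ofLp ≠ 0 := fun j h => by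
    have h' : v j = 0 := WithLp.ofLp_injective 2 h
    simpa [h'] using v.norm_eq_one j
  choose Z hZ hZX hZ0 using exists_smooth_eigenvalue hz (charpoly_eq_prod hz hv0 fun j => (hv j).1)
  have hinj : Function.Injective fun k => Z k X := by simpa only [hZX] using hz
  refine ⟨Z, fun s Y => lagrange Y (fun k => Z k Y) s 0 0, fun s => ?_, fun s => ?_, ?_⟩
  -- Regularity `ω` at the point spreads to a neighbourhood, whereas `∞` at a point alone would not.
  · filter_upwards [(hZ s).eventually (by simp)] with Y hY
    exact hY.of_le le_top
  · have h := contDiffAt_matrix.mp (contDiffAt_lagrange contDiffAt_id hZ hinj s) 0 0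
    filter_upwards [h.eventually (by simp)] with Y hY
    exact hY.of_le le_top
  · have hne : ∀ᶠ Y in 𝓝 X, ∀ j k, j ≠ k → Z j Y ≠ Z k Y := by
      rw [eventually_all]
      intro j
      rw [eventually_all]
      intro k
      by_cases hjk : j = k
      · exact Eventually.of_forall fun Y h => absurd hjk h
      · filter_upwards [((hZ j).continuousAt.sub (hZ k).continuousAt).eventually_ne
          (sub_ne_zero.mpr (hinj.ne hjk))] with Y hY _ using sub_ne_zero.mp hY
    filter_upwards [hne, eventually_all.mpr hZ0] with Y hYne hY0 hY
    have hYinj : Function.Injective fun k => Z k Y := fun j k hjk => by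
      by_contra h
      exact hYne j k h hjk
    have hYu := conjTranspose_mul_of_mem_cmvSet hY
    choose w hw hYw using fun j => exists_mulVec_eq_zero_iff.mpr (hY0 j)
    obtain ⟨b, hb⟩ := exists_eigenbasis_of_injective finrank_euclideanSpace_fin
      (inner_mulVec_of_unitary hYu) hYinj (w := fun j => WithLp.toLp 2 (w j))
      (fun j h => hw j (congrArg WithLp.ofLp h)) (fun j => by
        rw [toEuclideanLin_eq_smul_iff]
        have := hYw j
        rw [sub_mulVec, smul_mulVec, one_mulVec, sub_eq_zero] at this
        exact this.symm)
    have hdata : IsSpectralData Y (fun k => Z k Y) fun j => ((‖(b j) 0‖ ^ 2 : ℝ) : ℂ) :=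
      ⟨hYinj, b, fun j => ⟨toEuclideanLin_eq_smul_iff.mp (hb j), rfl⟩⟩
    obtain ⟨P, hP, hP0⟩ := hdata.exists_resolution hYu
    simpa only [hP.lagrange_eq, hP0] using hdata

/-! ### First variation of the spectral data -/

section Variation

variable {X V Q : Matrix (Fin n) (Fin n) ℂ} {z : Fin n → ℂ} {P : Fin n → Matrix (Fin n) (Fin n) ℂ}
  {t : Fin n} {ζ : ℂ}

/-- Here `V`, `Q`, `ζ` are the derivatives of `X`, `P t`, `z t`, and `h₂` differentiates `X P = z
P`. Multiplying by `P t` on the left cancels the terms in `Q`. -/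
theorem IsSpectralResolution.eigenvalue_variation (h : IsSpectralResolution X z P)
    (h₂ : V * P t + X * Q = ζ • P t + z t • Q) : ζ = trace (P t * V) := by
  have e := congrArg (fun Y => P t * Y) h₂
  simp only [mul_add, ← mul_assoc, h.mul_right, mul_smul_comm, smul_mul_assoc, h.mul_self] at e
  have e' := congrArg trace (add_right_cancel e)
  rw [trace_mul_comm, ← mul_assoc, h.mul_self, trace_smul, h.trace_eq, smul_eq_mul, mul_one] at e'
  exact e'.symm

/-- Differentiating `P P = P` gives `P Q P = 0`, and the equations for `X P` and `P X` determine the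
off-diagonal blocks `P k * Q` and `Q * P k`. Inserting `∑ P k = 1` reassembles `Q`. -/
theorem IsSpectralResolution.projection_variation (h : IsSpectralResolution X z P)
    (h₁ : Q * P t + P t * Q = Q) (h₂ : V * P t + X * Q = ζ • P t + z t • Q)
    (h₃ : Q * X + P t * V = ζ • P t + z t • Q) :
    Q = ∑ k ∈ Finset.univ.erase t, (z t - z k)⁻¹ • (P k * V * P t + P t * V * P k) := by
  have h0 : P t * Q * P t = 0 := by
    have e := congrArg (fun Y => P t * Y * P t) h₁
    simp only [mul_add, add_mul, ← mul_assoc, h.mul_self] at e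
    simpa only [mul_assoc, h.mul_self, add_eq_left] using e
  have hl : ∀ k, k ≠ t → P k * Q = (z t - z k)⁻¹ • (P k * V * P t) := by
    intro k hk
    have e := congrArg (fun Y => P k * Y) h₂
    simp only [mul_add, ← mul_assoc, h.mul_right, mul_smul_comm, smul_mul_assoc,
      h.mul_of_ne k t hk, smul_zero, zero_add] at e
    rw [← eq_sub_iff_add_eq, ← sub_smul] at e
    rw [e, smul_smul, inv_mul_cancel₀ (sub_ne_zero.mpr (h.injective.ne hk.symm)), one_smul]
  have hr : ∀ k, k ≠ t → Q * P k = (z t - z k)⁻¹ • (P t * V * P k) := by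
    intro k hk
    have e := congrArg (fun Y => Y * P k) h₃
    simp only [add_mul, mul_assoc, h.mul_left, mul_smul_comm, smul_mul_assoc,
      h.mul_of_ne t k hk.symm, smul_zero, zero_add] at e
    rw [← eq_sub_iff_add_eq', ← sub_smul] at e
    rw [mul_assoc, e, smul_smul, inv_mul_cancel₀ (sub_ne_zero.mpr (h.injective.ne hk.symm)),
      one_smul]
  have el : Q * P t = ∑ k ∈ Finset.univ.erase t, (z t - z k)⁻¹ • (P k * V * P t) := by
    conv_lhs => rw [← one_mul (Q * P t), ← h.sum_eq, Finset.sum_mul,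
      ← Finset.add_sum_erase _ _ (Finset.mem_univ t), ← mul_assoc, h0, zero_add]
    refine Finset.sum_congr rfl fun k hk => ?_
    rw [← mul_assoc, hl k (Finset.ne_of_mem_erase hk), smul_mul_assoc, mul_assoc _ (P t), h.mul_self]
  have er : P t * Q = ∑ k ∈ Finset.univ.erase t, (z t - z k)⁻¹ • (P t * V * P k) := by
    conv_lhs => rw [← mul_one (P t * Q), ← h.sum_eq, Finset.mul_sum,
      ← Finset.add_sum_erase _ _ (Finset.mem_univ t), h0, zero_add]
    refine Finset.sum_congr rfl fun k hk => ?_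
    rw [mul_assoc, hr k (Finset.ne_of_mem_erase hk), mul_smul_comm, ← mul_assoc, ← mul_assoc,
      h.mul_self]
  rw [← h₁, el, er, ← Finset.sum_add_distrib]
  simp only [smul_add]

end Variation

/-- The matrix representing the derivative of the `t`-th mass with respect to the trace form. -/
noncomputable def massGrad [NeZero n] (z : Fin n → ℂ) (P : Fin n → Matrix (Fin n) (Fin n) ℂ)
    (t : Fin n) : Matrix (Fin n) (Fin n) ℂ :=
  ∑ k ∈ Finset.univ.erase t,
    (z t - z k)⁻¹ • (P t * single 0 0 1 * P k + P k * single 0 0 1 * P t)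

theorem trace_mul_single_mul [NeZero n] (A B : Matrix (Fin n) (Fin n) ℂ) :
    trace (A * single 0 0 1 * B) = (B * A) 0 0 := by
  rw [trace_mul_comm, ← mul_assoc, trace_mul_single]
  simp

theorem trace_massGrad_mul [NeZero n] (z : Fin n → ℂ) (P : Fin n → Matrix (Fin n) (Fin n) ℂ)
    (t : Fin n) (V : Matrix (Fin n) (Fin n) ℂ) : trace (massGrad z P t * V) =
      (∑ k ∈ Finset.univ.erase t, (z t - z k)⁻¹ • (P k * V * P t + P t * V * P k)) 0 0 := by
  rw [massGrad, Finset.sum_mul, trace_sum, Matrix.sum_apply]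
  refine Finset.sum_congr rfl fun k _ => ?_
  rw [smul_mul_assoc, trace_smul, Matrix.smul_apply, add_mul, trace_add, Matrix.add_apply,
    mul_assoc (P t * _), mul_assoc (P k * _), trace_mul_single_mul, trace_mul_single_mul]

/-- The derivatives are controlled only along Hamiltonian vectors: these are velocities of curves of
CMV matrices, on which `Z` and `M` are true spectral data and the Lagrange polynomial is a true
eigenprojection. -/
theorem IsLocalSpectralFamily.fderiv_eq [NeZero n] {C : Matrix (Fin n) (Fin n) ℂ}
    (hC : C ∈ cmvSet n) {Z M : Fin n → Matrix (Fin n) (Fin n) ℂ → ℂ}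
    (h : IsLocalSpectralFamily C Z M) {P : Fin n → Matrix (Fin n) (Fin n) ℂ}
    (hP : IsSpectralResolution C (fun k => Z k C) P) (G : Matrix (Fin n) (Fin n) ℂ) (t : Fin n) :
    fderiv ℝ (Z t) C (hamiltonian C G) = trace (P t * hamiltonian C G) ∧
      fderiv ℝ (M t) C (hamiltonian C G)
        = trace (massGrad (fun k => Z k C) P t * hamiltonian C G) := by
  obtain ⟨hZ, hM, hdata⟩ := h
  obtain ⟨γ, hγ0, hγ, hγC⟩ := exists_curve hC G
  set V := hamiltonian C G
  have hZC : ∀ k, ContDiffAt ℝ ∞ (Z k) C := fun k => (hZ k).self_of_nhds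
  have hMC : ∀ k, ContDiffAt ℝ ∞ (M k) C := fun k => (hM k).self_of_nhds
  have hL : ContDiffAt ℝ ∞ (fun Y => lagrange Y (fun k => Z k Y) t) C :=
    contDiffAt_lagrange contDiffAt_id hZC hP.injective t
  have hfd : ∀ {F : Type} [NormedAddCommGroup F] [NormedSpace ℝ F]
      {f : Matrix (Fin n) (Fin n) ℂ → F}, ContDiffAt ℝ ∞ f C →
      HasDerivAt (fun τ => f (γ τ)) (fderiv ℝ f C V) 0 := by
    intro F _ _ f hf
    have hf' : HasFDerivAt f (fderiv ℝ f C) (γ 0) := by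
      rw [hγ0]
      exact (hf.differentiableAt (by simp)).hasFDerivAt
    exact hf'.comp_hasDerivAt 0 hγ
  have hz' := hfd (hZC t)
  have hm' := hfd (hMC t)
  set Q := fderiv ℝ (fun Y => lagrange Y (fun k => Z k Y) t) C V
  have hq' : HasDerivAt (fun τ => lagrange (γ τ) (fun k => Z k (γ τ)) t) Q 0 := hfd hL
  have hq0 : lagrange (γ 0) (fun k => Z k (γ 0)) t = P t := by
    rw [hγ0]
    exact hP.lagrange_eq t
  have hev : ∀ᶠ τ in 𝓝 (0 : ℝ), ∃ R, IsSpectralResolution (γ τ) (fun k => Z k (γ τ)) R ∧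
      R t 0 0 = M t (γ τ) := by
    have hdata' := hγ.continuousAt.eventually (hγ0.symm ▸ hdata)
    filter_upwards [hγC, hdata'] with τ h1 h2
    obtain ⟨R, hR, hR0⟩ := (h2 h1).exists_resolution (conjTranspose_mul_of_mem_cmvSet h1)
    exact ⟨R, hR, hR0 t⟩
  have hsmul : HasDerivAt (fun τ => Z t (γ τ) • lagrange (γ τ) (fun k => Z k (γ τ)) t)
      (fderiv ℝ (Z t) C V • P t + Z t C • Q) 0 := by
    rw [hasDerivAt_matrix] at hq' ⊢
    intro i j
    have := hz'.mul (hq' i j)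
    rw [hq0, hγ0] at this
    exact this
  have e₁ : Q * P t + P t * Q = Q := by
    have h1 := hq'.matrix_mul hq'
    rw [hq0] at h1
    refine h1.unique (hq'.congr_of_eventuallyEq ?_)
    filter_upwards [hev] with τ hτ
    obtain ⟨R, hR, -⟩ := hτ
    rw [hR.lagrange_eq, hR.mul_self]
  have e₂ : V * P t + C * Q = fderiv ℝ (Z t) C V • P t + Z t C • Q := by
    have h1 := hγ.matrix_mul hq'
    rw [hq0, hγ0] at h1
    refine h1.unique (hsmul.congr_of_eventuallyEq ?_)
    filter_upwards [hev] with τ hτ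
    obtain ⟨R, hR, -⟩ := hτ
    rw [hR.lagrange_eq, hR.mul_left]
  have e₃ : Q * C + P t * V = fderiv ℝ (Z t) C V • P t + Z t C • Q := by
    have h1 := hq'.matrix_mul hγ
    rw [hq0, hγ0] at h1
    refine h1.unique (hsmul.congr_of_eventuallyEq ?_)
    filter_upwards [hev] with τ hτ
    obtain ⟨R, hR, -⟩ := hτ
    rw [hR.lagrange_eq, hR.mul_right]
  refine ⟨hP.eigenvalue_variation e₂, ?_⟩
  have e₄ : fderiv ℝ (M t) C V = Q 0 0 := by
    refine hm'.unique ((hasDerivAt_matrix.mp hq' 0 0).congr_of_eventuallyEq ?_)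
    filter_upwards [hev] with τ hτ
    obtain ⟨R, hR, hR0⟩ := hτ
    rw [hR.lagrange_eq, hR0]
  rw [e₄, hP.projection_variation e₁ e₂ e₃, trace_massGrad_mul]

/-! ### The brackets of the spectral data -/

theorem gdForm_zero_right (X G : Matrix (Fin n) (Fin n) ℂ) : gdForm X G 0 = 0 := by
  simp [gdForm_eq_pairing_hamiltonian, pairing]

theorem gdForm_zero_left (X G : Matrix (Fin n) (Fin n) ℂ) : gdForm X 0 G = 0 := by
  rw [gdForm_antisymm, gdForm_zero_right, neg_zero]

/-- The bracket only depends on the derivatives along the Hamiltonian vectors. -/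
theorem gdBracketReal_eq_gdForm {φ₁ φ₂ : Matrix (Fin n) (Fin n) ℂ → ℝ}
    {X G₁ G₂ : Matrix (Fin n) (Fin n) ℂ}
    (h₁ : ∀ G, fderiv ℝ φ₁ X (hamiltonian X G) = pairing G₁ (hamiltonian X G))
    (h₂ : ∀ G, fderiv ℝ φ₂ X (hamiltonian X G) = pairing G₂ (hamiltonian X G)) :
    gdBracketReal φ₁ φ₂ X = gdForm X G₁ G₂ := by
  change gdForm X (grad φ₁ X) (grad φ₂ X) = gdForm X G₁ G₂
  -- The second gradient is replaced directly; antisymmetry puts the first one in its place so that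
  -- it can be replaced too.
  rw [gdForm_eq_pairing_hamiltonian, pairing_grad, h₂, ← gdForm_eq_pairing_hamiltonian,
    gdForm_antisymm, gdForm_eq_pairing_hamiltonian, pairing_grad, h₁,
    ← gdForm_eq_pairing_hamiltonian, ← gdForm_antisymm]

theorem pairing_I_smul (A B : Matrix (Fin n) (Fin n) ℂ) :
    pairing (Complex.I • A) B = (trace (A * B)).re := by
  simp [pairing]

theorem fderiv_re_apply {f : Matrix (Fin n) (Fin n) ℂ → ℂ} {X : Matrix (Fin n) (Fin n) ℂ}
    (hf : DifferentiableAt ℝ f X) (V : Matrix (Fin n) (Fin n) ℂ) :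
    fderiv ℝ (fun Y => (f Y).re) X V = (fderiv ℝ f X V).re := by
  have h : HasFDerivAt (fun Y => (f Y).re) (Complex.reCLM ∘L fderiv ℝ f X) X :=
    Complex.reCLM.hasFDerivAt.comp X hf.hasFDerivAt
  rw [h.fderiv]
  rfl

theorem fderiv_im_apply {f : Matrix (Fin n) (Fin n) ℂ → ℂ} {X : Matrix (Fin n) (Fin n) ℂ}
    (hf : DifferentiableAt ℝ f X) (V : Matrix (Fin n) (Fin n) ℂ) :
    fderiv ℝ (fun Y => (f Y).im) X V = (fderiv ℝ f X V).im := by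
  have h : HasFDerivAt (fun Y => (f Y).im) (Complex.imCLM ∘L fderiv ℝ f X) X :=
    Complex.imCLM.hasFDerivAt.comp X hf.hasFDerivAt
  rw [h.fderiv]
  rfl

section Brackets

variable {X : Matrix (Fin n) (Fin n) ℂ} {z : Fin n → ℂ} {P : Fin n → Matrix (Fin n) (Fin n) ℂ}

/-- Conjugation inverts points of the unit circle, so these quotients are purely imaginary. -/
theorem IsSpectralResolution.conj_div (h : IsSpectralResolution X z P) (s t : Fin n) :
    conj ((z s + z t) / (z s - z t)) = -((z s + z t) / (z s - z t)) := by
  have hz : ∀ k, conj (z k) = (z k)⁻¹ := fun k => eq_inv_of_mul_eq_one_left (h.conj_mul k)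
  have hs : z s ≠ 0 := right_ne_zero_of_mul (by rw [h.conj_mul]; exact one_ne_zero)
  have ht : z t ≠ 0 := right_ne_zero_of_mul (by rw [h.conj_mul]; exact one_ne_zero)
  by_cases hst : s = t
  · simp [hst]
  have h1 : z s - z t ≠ 0 := sub_ne_zero.mpr (h.injective.ne hst)
  have h2 : z t - z s ≠ 0 := sub_ne_zero.mpr (h.injective.ne (Ne.symm hst))
  rw [map_div₀, map_add, map_sub, hz, hz, inv_add_inv hs ht, inv_sub_inv hs ht,
    div_div_div_cancel_right₀ (mul_ne_zero hs ht), ← neg_sub (z s), div_neg]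

/-- `P s` and `P t` commute with `X`, so left and right translates agree and both antisymmetric
parts vanish. -/
theorem IsSpectralResolution.gdForm_eigenvalue_eigenvalue (h : IsSpectralResolution X z P)
    (c d : ℂ) (s t : Fin n) : gdForm X (c • P s) (d • P t) = 0 := by
  rw [gdForm_of_add_sub (S := (c * z s) • P s) (S' := (d * z t) • P t) (T := 0) (T' := 0)]
  · have h0 : skewPart (0 : Matrix (Fin n) (Fin n) ℂ) = 0 := skewPart_eq_self (by simp)
    simp [lowerPart, h0, pairing]
  all_goals simp [h.mul_left, h.mul_right, smul_smul]

variable [NeZero n] {m : Fin n → ℝ}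

/-- Twice the part of the translated gradients of the `t`-th mass which is common to the left and
the right translation, up to the factor `i`. -/
noncomputable def massSym (z : Fin n → ℂ) (P : Fin n → Matrix (Fin n) (Fin n) ℂ)
    (t : Fin n) : Matrix (Fin n) (Fin n) ℂ :=
  ∑ k ∈ Finset.univ.erase t, ((z t + z k) / (z t - z k)) •
    (P t * single 0 0 1 * P k + P k * single 0 0 1 * P t)

/-- Half the difference of the translated gradients of the `t`-th mass. -/
noncomputable def massAnti (P : Fin n → Matrix (Fin n) (Fin n) ℂ) (t : Fin n) :
    Matrix (Fin n) (Fin n) ℂ :=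
  (Complex.I / 2) • (P t * single 0 0 1 - single 0 0 1 * P t)

theorem IsSpectralResolution.massAnti_eq_sum (h : IsSpectralResolution X z P) (t : Fin n) :
    massAnti P t = (Complex.I / 2) • ∑ k ∈ Finset.univ.erase t,
      (P t * single 0 0 1 * P k - P k * single 0 0 1 * P t) := by
  have h1 : P t * single 0 0 1 - single 0 0 1 * P t
      = ∑ k, (P t * single 0 0 1 * P k - P k * single 0 0 1 * P t) := by
    rw [Finset.sum_sub_distrib, ← Finset.mul_sum, h.sum_eq, mul_one, ← Finset.sum_mul,
      ← Finset.sum_mul, h.sum_eq, one_mul]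
  rw [massAnti, h1, ← Finset.add_sum_erase _ _ (Finset.mem_univ t), sub_self, zero_add]

/-- Multiplication by `X` produces the factors `z t` and `z k`, and `z t / (z t - z k)` and `z k /
(z t - z k)` are half of `(z t + z k) / (z t - z k) ± 1`. -/
theorem IsSpectralResolution.mul_massGrad (h : IsSpectralResolution X z P) (t : Fin n) :
    X * (Complex.I • massGrad z P t) = (Complex.I / 2) • massSym z P t + massAnti P t := by
  rw [h.massAnti_eq_sum, massGrad, massSym, ← smul_add, ← Finset.sum_add_distrib, mul_smul_comm,
    Finset.mul_sum, Finset.smul_sum, Finset.smul_sum]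
  refine Finset.sum_congr rfl fun k hk => ?_
  have hne : z t - z k ≠ 0 := sub_ne_zero.mpr (h.injective.ne (Finset.ne_of_mem_erase hk).symm)
  rw [mul_smul_comm, mul_add, ← mul_assoc, ← mul_assoc, ← mul_assoc, ← mul_assoc, h.mul_left,
    h.mul_left, smul_mul_assoc, smul_mul_assoc, smul_mul_assoc, smul_mul_assoc]
  match_scalars <;> field_simp <;> ring

theorem IsSpectralResolution.massGrad_mul (h : IsSpectralResolution X z P) (t : Fin n) :
    (Complex.I • massGrad z P t) * X = (Complex.I / 2) • massSym z P t - massAnti P t := by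
  rw [h.massAnti_eq_sum, massGrad, massSym, ← smul_sub, ← Finset.sum_sub_distrib, smul_mul_assoc,
    Finset.sum_mul, Finset.smul_sum, Finset.smul_sum]
  refine Finset.sum_congr rfl fun k hk => ?_
  have hne : z t - z k ≠ 0 := sub_ne_zero.mpr (h.injective.ne (Finset.ne_of_mem_erase hk).symm)
  rw [smul_mul_assoc, add_mul, mul_assoc _ (P k), mul_assoc _ (P t), h.mul_right, h.mul_right,
    mul_smul_comm, mul_smul_comm]
  match_scalars <;> field_simp <;> ring

/-- Up to a skew-Hermitian matrix, `massAnti` is `i (P E - m E)` with `E = single 0 0 1`. This lives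
in the first column and its corner vanishes because `P t 0 0 = m t`, so it belongs to `𝔩`. -/
theorem IsSpectralResolution.skewPart_massAnti (h : IsSpectralResolution X z P)
    (hm : ∀ k, P k 0 0 = m k) (t : Fin n) :
    skewPart (massAnti P t) = -(Complex.I / 2) •
      (single 0 0 1 * P t + P t * single 0 0 1 - (2 * m t : ℂ) • single 0 0 1) := by
  have hI : star (Complex.I / 2) = -(Complex.I / 2) := by
    simp [neg_div]
  have hE : (single (0 : Fin n) (0 : Fin n) (1 : ℂ))ᴴ = single 0 0 1 := by
    rw [conjTranspose_single, star_one]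
  have hsplit : massAnti P t = Complex.I • (P t * single 0 0 1 - (m t : ℂ) • single 0 0 1)
      + -(Complex.I / 2) •
        (single 0 0 1 * P t + P t * single 0 0 1 - (2 * m t : ℂ) • single 0 0 1) := by
    rw [massAnti]
    match_scalars <;> ring
  have hentry : ∀ i j, (Complex.I • (P t * single 0 0 1 - (m t : ℂ) • single 0 0 1) :
      Matrix (Fin n) (Fin n) ℂ) i j
      = if j = 0 then Complex.I * (P t i 0 - if i = 0 then (m t : ℂ) else 0) else 0 := by
    intro i j
    rw [Matrix.smul_apply, Matrix.sub_apply, Matrix.smul_apply]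
    by_cases hj : j = 0
    · subst hj
      by_cases hi : i = 0
      · simp [hi]
      · simp [hi, Ne.symm hi]
    · rw [mul_single_apply_of_ne _ _ _ _ _ hj]
      simp [Ne.symm hj, hj]
  rw [hsplit]
  apply skewPart_unique
  · simp only [conjTranspose_smul, conjTranspose_sub, conjTranspose_add, conjTranspose_mul, hE,
      h.herm, star_neg, hI, star_mul', Complex.star_def, Complex.conj_ofReal, map_ofNat]
    match_scalars <;> ring
  · intro i j hij
    rw [hentry, if_neg (fun hj => by simp [hj] at hij)]
  · intro i
    rw [hentry]
    by_cases hi : i = 0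
    · simp [hi, hm]
    · simp [hi]

theorem IsSpectralResolution.lowerPart_massAnti (h : IsSpectralResolution X z P)
    (hm : ∀ k, P k 0 0 = m k) (t : Fin n) :
    lowerPart (massAnti P t) = Complex.I • (P t * single 0 0 1 - (m t : ℂ) • single 0 0 1) := by
  rw [lowerPart, h.skewPart_massAnti hm, massAnti]
  match_scalars <;> ring

theorem trace_mul_single_zero (A : Matrix (Fin n) (Fin n) ℂ) : trace (A * single 0 0 1) = A 0 0 := by
  rw [trace_mul_single]
  simp

theorem mul_single_mul_apply_zero (A B : Matrix (Fin n) (Fin n) ℂ) :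
    (A * single 0 0 1 * B : Matrix (Fin n) (Fin n) ℂ) 0 0 = A 0 0 * B 0 0 := by
  rw [mul_apply, Finset.sum_eq_single 0]
  · simp
  · intro j _ hj
    rw [mul_single_apply_of_ne _ _ _ _ _ hj, zero_mul]
  · simp

theorem massSym_apply_zero (hm : ∀ k, P k 0 0 = m k) (t : Fin n) : massSym z P t 0 0
    = 2 * m t * ∑ k ∈ Finset.univ.erase t, (z t + z k) / (z t - z k) * m k := by
  rw [massSym, Matrix.sum_apply, Finset.mul_sum]
  refine Finset.sum_congr rfl fun k _ => ?_
  rw [Matrix.smul_apply, Matrix.add_apply, mul_single_mul_apply_zero, mul_single_mul_apply_zero,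
    hm, hm, smul_eq_mul]
  ring

/-- Orthogonality of the projections leaves only the summand `k = t`. -/
theorem IsSpectralResolution.massSym_mul_apply_zero (h : IsSpectralResolution X z P)
    (hm : ∀ k, P k 0 0 = m k) {s t : Fin n} (hst : s ≠ t) :
    (massSym z P s * P t) 0 0 = (z s + z t) / (z s - z t) * (m s * m t) := by
  rw [massSym, Finset.sum_mul, Matrix.sum_apply, Finset.sum_eq_single t]
  · rw [smul_mul_assoc, add_mul, mul_assoc _ (P t), mul_assoc _ (P s), h.mul_of_ne s t hst,
      h.mul_self, mul_zero, add_zero, Matrix.smul_apply, mul_single_mul_apply_zero, hm, hm,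
      smul_eq_mul]
  · intro k _ hk
    rw [smul_mul_assoc, add_mul, mul_assoc _ (P k), mul_assoc _ (P s), h.mul_of_ne s t hst,
      h.mul_of_ne k t hk, mul_zero, mul_zero, add_zero, smul_zero, Matrix.zero_apply]
  · intro ht
    exact absurd (Finset.mem_erase.mpr ⟨hst.symm, Finset.mem_univ t⟩) ht

theorem IsSpectralResolution.mul_massSym_apply_zero (h : IsSpectralResolution X z P)
    (hm : ∀ k, P k 0 0 = m k) {s t : Fin n} (hst : s ≠ t) :
    (P t * massSym z P s) 0 0 = (z s + z t) / (z s - z t) * (m s * m t) := by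
  rw [massSym, Finset.mul_sum, Matrix.sum_apply, Finset.sum_eq_single t]
  · rw [mul_smul_comm, mul_add, ← mul_assoc, ← mul_assoc, ← mul_assoc, ← mul_assoc,
      h.mul_of_ne t s hst.symm, h.mul_self, zero_mul, zero_mul, zero_add, Matrix.smul_apply,
      mul_single_mul_apply_zero, hm, hm, smul_eq_mul]
    ring
  · intro k _ hk
    rw [mul_smul_comm, mul_add, ← mul_assoc, ← mul_assoc, ← mul_assoc, ← mul_assoc,
      h.mul_of_ne t s hst.symm, h.mul_of_ne t k hk.symm, zero_mul, zero_mul, zero_mul,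
      add_zero, smul_zero, Matrix.zero_apply]
  · intro ht
    exact absurd (Finset.mem_erase.mpr ⟨hst.symm, Finset.mem_univ t⟩) ht

/-- The scalar `c` is `i` for the real part of the eigenvalue and `1` for its imaginary part. -/
theorem IsSpectralResolution.gdForm_eigenvalue_mass (h : IsSpectralResolution X z P)
    (hm : ∀ k, P k 0 0 = m k) (c : ℂ) (s t : Fin n) :
    gdForm X (c • P s) (Complex.I • massGrad z P t)
      = 2 * (c * z s).re * (m t * ((if s = t then 1 else 0) - m s)) := by
  rw [gdForm_of_add_sub (S := (c * z s) • P s) (S' := (Complex.I / 2) • massSym z P t) (T := 0)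
    (T' := massAnti P t) (by simp [h.mul_left, smul_smul]) (by simp [h.mul_right, smul_smul])
    (h.mul_massGrad t) (h.massGrad_mul t), skewPart_eq_self (by simp), h.lowerPart_massAnti hm]
  have hPP : (P s * P t) 0 0 = ((if s = t then m t else 0 : ℝ) : ℂ) := by
    split_ifs with hst
    · rw [hst, h.mul_self, hm]
    · simp [h.mul_of_ne s t hst]
  have e : trace ((c * z s) • P s * Complex.I • (P t * single 0 0 1 - (m t : ℂ) • single 0 0 1))
      = Complex.I * (c * z s) * ((m t * ((if s = t then 1 else 0) - m s) : ℝ) : ℂ) := by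
    rw [smul_mul_assoc, mul_smul_comm, mul_sub, mul_smul_comm, ← mul_assoc, trace_smul, trace_smul,
      trace_sub, trace_smul, trace_mul_single_zero, trace_mul_single_zero, hPP, hm]
    simp only [smul_eq_mul]
    split_ifs <;> push_cast <;> ring
  rw [pairing, e, pairing, zero_mul, trace_zero, Complex.im_mul_ofReal, Complex.I_mul_im]
  simp
  ring

theorem IsSpectralResolution.gdForm_mass_mass (h : IsSpectralResolution X z P)
    (hm : ∀ k, P k 0 0 = m k) {s t : Fin n} (hst : s ≠ t) :
    gdForm X (Complex.I • massGrad z P s) (Complex.I • massGrad z P t)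
      = (-2 * (m s * m t) * ((z s + z t) / (z s - z t)
        - ∑ k ∈ Finset.univ.erase s, (z s + z k) / (z s - z k) * m k
        + ∑ k ∈ Finset.univ.erase t, (z t + z k) / (z t - z k) * m k)).im := by
  rw [gdForm_of_add_sub (h.mul_massGrad s) (h.massGrad_mul s) (h.mul_massGrad t)
    (h.massGrad_mul t), h.lowerPart_massAnti hm, h.skewPart_massAnti hm]
  have e₁ : trace ((Complex.I / 2) • massSym z P s
      * Complex.I • (P t * single 0 0 1 - (m t : ℂ) • single 0 0 1))
      = -(1 / 2) * ((massSym z P s * P t) 0 0 - m t * massSym z P s 0 0) := by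
    rw [smul_mul_assoc, mul_smul_comm, mul_sub, mul_smul_comm, ← mul_assoc, trace_smul, trace_smul,
      trace_sub, trace_smul, trace_mul_single_zero, trace_mul_single_zero, smul_smul, smul_eq_mul,
      smul_eq_mul]
    linear_combination (1 / 2 * ((massSym z P s * P t) 0 0 - m t * massSym z P s 0 0))
      * Complex.I_mul_I
  have e₂ : trace (-(Complex.I / 2) •
      (single 0 0 1 * P s + P s * single 0 0 1 - (2 * m s : ℂ) • single 0 0 1)
      * (Complex.I / 2) • massSym z P t)
      = (1 / 4) * ((P s * massSym z P t) 0 0 + (massSym z P t * P s) 0 0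
        - 2 * m s * massSym z P t 0 0) := by
    rw [smul_mul_assoc, mul_smul_comm, sub_mul, add_mul, smul_mul_assoc, trace_smul, trace_smul,
      trace_sub, trace_add, trace_smul, trace_mul_single_mul, mul_assoc, trace_mul_comm,
      trace_mul_single_zero, trace_mul_comm (single 0 0 1), trace_mul_single_zero, smul_eq_mul,
      smul_eq_mul, smul_eq_mul]
    linear_combination (-(1 / 4) * ((P s * massSym z P t) 0 0 + (massSym z P t * P s) 0 0
        - 2 * m s * massSym z P t 0 0)) * Complex.I_mul_I
  have hw : (z t + z s) / (z t - z s) = -((z s + z t) / (z s - z t)) := by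
    rw [← neg_sub (z s), div_neg, add_comm]
  rw [pairing, pairing, e₁, e₂, h.massSym_mul_apply_zero hm hst, h.massSym_mul_apply_zero hm hst.symm,
    h.mul_massSym_apply_zero hm hst.symm, massSym_apply_zero hm, massSym_apply_zero hm, hw]
  have h2 : ∀ w : ℂ, 2 * w.im = (2 * w).im := fun w => by simp
  rw [h2, h2, ← Complex.add_im]
  congr 1
  ring

end Brackets

/-- The derivatives of spectral data along the Hamiltonian vectors at a CMV matrix, represented by
matrices that only depend on the eigenprojections. -/
theorem IsLocalSpectralFamily.fderiv_re_im [NeZero n] {C : Matrix (Fin n) (Fin n) ℂ}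
    (hC : C ∈ cmvSet n) {Z M : Fin n → Matrix (Fin n) (Fin n) ℂ → ℂ}
    (h : IsLocalSpectralFamily C Z M) {P : Fin n → Matrix (Fin n) (Fin n) ℂ}
    (hP : IsSpectralResolution C (fun k => Z k C) P) (G : Matrix (Fin n) (Fin n) ℂ) (t : Fin n) :
    fderiv ℝ (fun Y => (Z t Y).re) C (hamiltonian C G)
        = pairing (Complex.I • P t) (hamiltonian C G) ∧
      fderiv ℝ (fun Y => (Z t Y).im) C (hamiltonian C G)
        = pairing ((1 : ℂ) • P t) (hamiltonian C G) ∧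
      fderiv ℝ (fun Y => (M t Y).re) C (hamiltonian C G)
        = pairing (Complex.I • massGrad (fun k => Z k C) P t) (hamiltonian C G) ∧
      fderiv ℝ (fun Y => (M t Y).im) C (hamiltonian C G) = pairing 0 (hamiltonian C G) := by
  obtain ⟨hz, hm⟩ := h.fderiv_eq hC hP G t
  have hZd : DifferentiableAt ℝ (Z t) C := (h.1 t).self_of_nhds.differentiableAt (by simp)
  have hMd : DifferentiableAt ℝ (M t) C := (h.2.1 t).self_of_nhds.differentiableAt (by simp)
  refine ⟨?_, ?_, ?_, ?_⟩
  · rw [fderiv_re_apply hZd, hz, pairing_I_smul]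
  · rw [fderiv_im_apply hZd, hz, one_smul, pairing]
  · rw [fderiv_re_apply hMd, hm, pairing_I_smul]
  -- Masses are real at CMV matrices, so the imaginary part of `M t` is constant along the curve and
  -- is represented by `0`.
  · obtain ⟨γ, hγ0, hγ, hγC⟩ := exists_curve hC G
    have hd : HasDerivAt (fun τ => M t (γ τ)) (fderiv ℝ (M t) C (hamiltonian C G)) 0 := by
      have hMd' : HasFDerivAt (M t) (fderiv ℝ (M t) C) (γ 0) := hγ0.symm ▸ hMd.hasFDerivAt
      exact hMd'.comp_hasDerivAt 0 hγ
    have hd' : HasDerivAt (fun τ => (M t (γ τ)).im) (fderiv ℝ (M t) C (hamiltonian C G)).im 0 :=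
      Complex.imCLM.hasFDerivAt.comp_hasDerivAt (0 : ℝ) hd
    have hreal : (fun τ => (M t (γ τ)).im) =ᶠ[𝓝 0] fun _ => 0 := by
      filter_upwards [hγC, hγ.continuousAt.eventually (hγ0.symm ▸ h.2.2)] with τ h1 h2
      obtain ⟨-, v, hv⟩ := h2 h1
      have hvt : M t (γ τ) = _ := (hv t).2
      rw [hvt, Complex.ofReal_im]
    rw [fderiv_im_apply hMd, hd'.unique ((hasDerivAt_const _ _).congr_of_eventuallyEq hreal)]
    simp [pairing]

end CMV

theorem theorem3p4 (n : ℕ) [NeZero n] (C : Matrix (Fin n) (Fin n) ℂ) (hC : C ∈ CMV.cmvSet n) :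
    (∃ Z M : Fin n → Matrix (Fin n) (Fin n) ℂ → ℂ, CMV.IsLocalSpectralFamily C Z M) ∧
    ∀ Z M : Fin n → Matrix (Fin n) (Fin n) ℂ → ℂ, CMV.IsLocalSpectralFamily C Z M →
      (∀ s t : Fin n, CMV.gdBracket (Z s) (Z t) C = 0) ∧
      (∀ s t : Fin n, CMV.gdBracket (Z s) (M t) C
        = 2 * Complex.I * Z s C * M t C * ((if s = t then 1 else 0) - M s C)) ∧
      (∀ s t : Fin n, s ≠ t → CMV.gdBracket (M s) (M t) C
        = 2 * Complex.I * M s C * M t C *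
          ((∑ k ∈ Finset.univ.erase s, (Z k C + Z s C) / (Z k C - Z s C) * M k C)
            + (∑ k ∈ Finset.univ.erase t, (Z t C + Z k C) / (Z t C - Z k C) * M k C)
            + (Z s C + Z t C) / (Z s C - Z t C))) ∧
      (∀ s : Fin n, CMV.gdBracket (M s) (M s) C = 0) := by
  refine ⟨CMV.exists_isLocalSpectralFamily hC, fun Z M h => ?_⟩
  have hdata := h.2.2.self_of_nhds hC
  obtain ⟨P, hP, hPM⟩ := hdata.exists_resolution (CMV.conjTranspose_mul_of_mem_cmvSet hC)
  obtain ⟨m, hm⟩ : ∃ m : Fin n → ℝ, ∀ k, M k C = m k := by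
    obtain ⟨-, v, hv⟩ := hdata
    exact ⟨fun k => ‖(v k) 0‖ ^ 2, fun k => (hv k).2⟩
  have hPm : ∀ k, P k 0 0 = m k := fun k => (hPM k).trans (hm k)
  have hZre := fun t G => (h.fderiv_re_im hC hP G t).1
  have hZim := fun t G => (h.fderiv_re_im hC hP G t).2.1
  have hMre := fun t G => (h.fderiv_re_im hC hP G t).2.2.1
  have hMim := fun t G => (h.fderiv_re_im hC hP G t).2.2.2
  refine ⟨fun s t => ?_, fun s t => ?_, fun s t hst => ?_, fun s => ?_⟩
  · rw [CMV.gdBracket, CMV.gdBracketReal_eq_gdForm (hZre s) (hZre t),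
      CMV.gdBracketReal_eq_gdForm (hZim s) (hZim t), CMV.gdBracketReal_eq_gdForm (hZre s) (hZim t),
      CMV.gdBracketReal_eq_gdForm (hZim s) (hZre t)]
    simp only [hP.gdForm_eigenvalue_eigenvalue]
    simp
  · rw [CMV.gdBracket, CMV.gdBracketReal_eq_gdForm (hZre s) (hMre t),
      CMV.gdBracketReal_eq_gdForm (hZim s) (hMim t), CMV.gdBracketReal_eq_gdForm (hZre s) (hMim t),
      CMV.gdBracketReal_eq_gdForm (hZim s) (hMre t)]
    simp only [hP.gdForm_eigenvalue_mass hPm, CMV.gdForm_zero_right, hm]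
    apply Complex.ext <;> split_ifs <;> simp <;> ring
  · rw [CMV.gdBracket, CMV.gdBracketReal_eq_gdForm (hMre s) (hMre t),
      CMV.gdBracketReal_eq_gdForm (hMim s) (hMim t), CMV.gdBracketReal_eq_gdForm (hMre s) (hMim t),
      CMV.gdBracketReal_eq_gdForm (hMim s) (hMre t), hP.gdForm_mass_mass hPm hst]
    simp only [CMV.gdForm_zero_right, CMV.gdForm_zero_left, hm, add_zero, sub_zero, Complex.ofReal_zero,
      mul_zero]
    have hneg : ∑ k ∈ Finset.univ.erase s, (Z k C + Z s C) / (Z k C - Z s C) * (m k : ℂ)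
        = -∑ k ∈ Finset.univ.erase s, (Z s C + Z k C) / (Z s C - Z k C) * (m k : ℂ) := by
      rw [← Finset.sum_neg_distrib]
      refine Finset.sum_congr rfl fun k _ => ?_
      rw [← neg_sub (Z s C), div_neg, add_comm, neg_mul]
    have hconj : ∀ r : Fin n, conj (∑ k ∈ Finset.univ.erase r,
        (Z r C + Z k C) / (Z r C - Z k C) * (m k : ℂ))
        = -∑ k ∈ Finset.univ.erase r, (Z r C + Z k C) / (Z r C - Z k C) * (m k : ℂ) := by
      intro r
      rw [map_sum, ← Finset.sum_neg_distrib]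
      refine Finset.sum_congr rfl fun k _ => ?_
      rw [map_mul, hP.conj_div, Complex.conj_ofReal, neg_mul]
    -- The bracket is real and equals `-2 μ_s μ_t` times an imaginary part; since the quotient and
    -- both sums are purely imaginary, this agrees with `2i μ_s μ_t` times the full bracketed
    -- expression.
    have hre : ∀ w : ℂ, conj w = -w → w.re = 0 := fun w hw => by
      have := congrArg Complex.re hw
      simp only [Complex.conj_re, Complex.neg_re] at this
      linarith
    have h₁ := hre _ (hP.conj_div s t)
    have h₂ := hre _ (hconj s)
    have h₃ := hre _ (hconj t)
    rw [hneg]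
    generalize (Z s C + Z t C) / (Z s C - Z t C) = w₁ at *
    generalize ∑ k ∈ Finset.univ.erase s, (Z s C + Z k C) / (Z s C - Z k C) * (m k : ℂ) = w₂ at *
    generalize ∑ k ∈ Finset.univ.erase t, (Z t C + Z k C) / (Z t C - Z k C) * (m k : ℂ) = w₃ at *
    apply Complex.ext
    · simp [h₁, h₂, h₃]
      ring
    · simp [h₁, h₂, h₃]
  · rw [CMV.gdBracket, CMV.gdBracketReal_eq_gdForm (hMre s) (hMre s),
      CMV.gdBracketReal_eq_gdForm (hMim s) (hMim s), CMV.gdBracketReal_eq_gdForm (hMre s) (hMim s),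
      CMV.gdBracketReal_eq_gdForm (hMim s) (hMre s)]
    simp only [CMV.gdForm_zero_right, CMV.gdForm_zero_left]
    have := CMV.gdForm_antisymm C (Complex.I • CMV.massGrad (fun k => Z k C) P s)
      (Complex.I • CMV.massGrad (fun k => Z k C) P s)
    rw [self_eq_neg.mp this]
    simp
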